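/- Let $\alpha,p\in(0,1)$ be fixed, put $q=1-p$, and let $z=z_{\alpha/2}$ be the upper $\alpha/2$ quantile of the standard normal distribution, i.e. $\Phi(z)=1-\alpha/2$. For $n\ge 1$ and $X\in\{0,1,\dots,n\}$ the two-sided $1-\alpha$ Clopper--Pearson interval has end points $p_L,p_U\in[0,1]$ defined by $$\sum_{k=X}^n\binom nk p_L^k(1-p_L)^{n-k}=\frac{\alpha}{2}\quad(X\ge 1),\qquad \sum_{k=0}^X\binom nk p_U^k(1-p_U)^{n-k}=\frac{\alpha}{2}\quad(X\le n-1),$$ with $p_L=0$ if $X=0$ and $p_U=1$ if $X=n$. Let $L_{CP}=p_U-p_L$ be its length, and let $X\sim\mathrm{Bin}(n,p)$. Then, as $n\to\infty$, $$E(L_{CP})=2z\,n^{-1/2}(pq)^{1/2}+n^{-1}+n^{-3/2}(pq)^{-1/2}\,\frac{z}{18}\Big(z^2-\frac52-17pq-13pq\,z^2\Big)+O(n^{-2}),$$ where the implied constant may depend on $\alpha$ and $p$. -/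

import Mathlib

/-- `P(Bin(n, θ) ≥ x)`, written as the explicit sum. -/
noncomputable def binomialUpperTail (n x : ℕ) (θ : ℝ) : ℝ :=
  ∑ k ∈ Finset.Icc x n, (n.choose k : ℝ) * θ ^ k * (1 - θ) ^ (n - k)

/-- `P(Bin(n, θ) ≤ x)`, written as the explicit sum (over `0 ≤ k ≤ x`). -/
noncomputable def binomialLowerTail (n x : ℕ) (θ : ℝ) : ℝ :=
  ∑ k ∈ Finset.range (x + 1), (n.choose k : ℝ) * θ ^ k * (1 - θ) ^ (n - k)

/-- Lower end point of the two-sided `1 - α` Clopper–Pearson interval for the observation `x`: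
`0` if `x = 0`, and otherwise the unique `θ ∈ [0, 1]` with `P(Bin(n, θ) ≥ x) = α / 2`
(the set below is a singleton, see `existsUnique_binomialUpperTail_eq`). -/
noncomputable def clopperPearsonLower (n : ℕ) (α : ℝ) (x : ℕ) : ℝ :=
  if x = 0 then 0 else sInf {θ : ℝ | θ ∈ Set.Icc 0 1 ∧ binomialUpperTail n x θ = α / 2}

/-- Upper end point of the two-sided `1 - α` Clopper–Pearson interval for the observation `x`:
`1` if `x = n`, and otherwise the unique `θ ∈ [0, 1]` with `P(Bin(n, θ) ≤ x) = α / 2`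
(the set below is a singleton, see `existsUnique_binomialLowerTail_eq`). -/
noncomputable def clopperPearsonUpper (n : ℕ) (α : ℝ) (x : ℕ) : ℝ :=
  if x = n then 1 else sInf {θ : ℝ | θ ∈ Set.Icc 0 1 ∧ binomialLowerTail n x θ = α / 2}

/-- Length of the two-sided `1 - α` Clopper–Pearson interval for the observation `x`. -/
noncomputable def clopperPearsonLength (n : ℕ) (α : ℝ) (x : ℕ) : ℝ :=
  clopperPearsonUpper n α x - clopperPearsonLower n α x

/-- Expectation of the length of the Clopper–Pearson interval when `X ~ Bin(n, p)`. -/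
noncomputable def expectedClopperPearsonLength (n : ℕ) (α : ℝ) (p : unitInterval) : ℝ :=
  ∫ x, clopperPearsonLength n α x ∂(ProbabilityTheory.binomial n p)

/-- The upper `β` quantile of the standard normal distribution,
i.e. its `(1 - β)`-quantile `inf {x | Φ(x) ≥ 1 - β}`. -/
noncomputable def stdNormalUpperQuantile (β : ℝ) : ℝ :=
  sInf {x : ℝ | 1 - β ≤ ProbabilityTheory.cdf (ProbabilityTheory.gaussianReal 0 1) x}

lemma binomialUpperTail_continuous (n x : ℕ) : Continuous (binomialUpperTail n x) := by
  unfold binomialUpperTail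
  fun_prop

lemma binomialUpperTail_hasDerivAt (n x : ℕ) (hx : x ≤ n) (θ : ℝ) :
    HasDerivAt (binomialUpperTail (n + 1) (x + 1))
      (((n : ℝ) + 1) * ((n.choose x : ℝ) * θ ^ x * (1 - θ) ^ (n - x))) θ := by
  have hB : ∀ m k : ℕ, (bernsteinPolynomial ℝ m k).eval θ
      = (m.choose k : ℝ) * θ ^ k * (1 - θ) ^ (m - k) := by
    intro m k
    simp [bernsteinPolynomial]
  have hf : binomialUpperTail (n + 1) (x + 1) = fun t =>
      (∑ k ∈ Finset.Ico x (n + 1), bernsteinPolynomial ℝ (n + 1) (k + 1)).eval t := by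
    funext t
    rw [Polynomial.eval_finsetSum, binomialUpperTail, ← Finset.Ico_add_one_right_eq_Icc,
      ← Finset.sum_Ico_add']
    simp [bernsteinPolynomial]
  rw [hf]
  refine (Polynomial.hasDerivAt _ θ).congr_deriv ?_
  rw [Polynomial.derivative_sum]
  simp only [bernsteinPolynomial.derivative_succ_aux]
  rw [← Finset.mul_sum, Polynomial.eval_mul, ← hB]
  have ht : ∑ k ∈ Finset.Ico x (n + 1),
      (bernsteinPolynomial ℝ n k - bernsteinPolynomial ℝ n (k + 1))
      = bernsteinPolynomial ℝ n x - bernsteinPolynomial ℝ n (n + 1) := by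
    have h := Finset.sum_Ico_sub (fun k => bernsteinPolynomial ℝ n k)
      (show x ≤ n + 1 by omega)
    rw [← neg_sub (bernsteinPolynomial ℝ n (n + 1)), ← h, ← Finset.sum_neg_distrib]
    simp
  rw [ht, bernsteinPolynomial.eq_zero_of_lt ℝ (Nat.lt_succ_self n)]
  simp

lemma binomialUpperTail_strictMonoOn (n x : ℕ) (hx0 : x ≠ 0) (hxn : x ≤ n) :
    StrictMonoOn (binomialUpperTail n x) (Set.Icc 0 1) := by
  obtain ⟨y, rfl⟩ := Nat.exists_eq_succ_of_ne_zero hx0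
  obtain ⟨m, rfl⟩ : ∃ m, n = m + 1 := ⟨n - 1, by omega⟩
  refine strictMonoOn_of_deriv_pos (convex_Icc 0 1)
    (binomialUpperTail_continuous _ _).continuousOn ?_
  intro θ hθ
  rw [interior_Icc] at hθ
  have hy : y ≤ m := by omega
  rw [Nat.succ_eq_add_one, (binomialUpperTail_hasDerivAt m y hy θ).deriv]
  have h1 : 0 < 1 - θ := by linarith [hθ.2]
  have h0 : 0 < θ := hθ.1
  have hc : (0 : ℝ) < m.choose y := by exact_mod_cast Nat.choose_pos hy
  positivity

lemma binomialUpperTail_zero (n x : ℕ) (hx0 : x ≠ 0) : binomialUpperTail n x 0 = 0 := by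
  refine Finset.sum_eq_zero fun k hk => ?_
  have : k ≠ 0 := by have := (Finset.mem_Icc.mp hk).1; omega
  simp [this]

lemma binomialUpperTail_one (n x : ℕ) (hxn : x ≤ n) : binomialUpperTail n x 1 = 1 := by
  rw [binomialUpperTail, Finset.sum_eq_single n]
  · simp
  · intro k hk hkn
    have : n - k ≠ 0 := by have := (Finset.mem_Icc.mp hk).2; omega
    simp [this]
  · intro h
    exact absurd (Finset.mem_Icc.mpr ⟨hxn, le_rfl⟩) h

lemma existsUnique_binomialUpperTail_eq (n x : ℕ) (hx0 : x ≠ 0) (hxn : x ≤ n) (c : ℝ)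
    (hc : c ∈ Set.Icc (0 : ℝ) 1) :
    ∃! θ : ℝ, θ ∈ Set.Icc (0 : ℝ) 1 ∧ binomialUpperTail n x θ = c := by
  have h := intermediate_value_Icc (zero_le_one' ℝ)
    (binomialUpperTail_continuous n x).continuousOn
  rw [binomialUpperTail_zero n x hx0, binomialUpperTail_one n x hxn] at h
  obtain ⟨θ, hθ, he⟩ := h hc
  refine ⟨θ, ⟨hθ, he⟩, fun t ht => ?_⟩
  exact (binomialUpperTail_strictMonoOn n x hx0 hxn).injOn ht.1 hθ (ht.2.trans he.symm)

lemma binomialLowerTail_eq (n x : ℕ) (hxn : x < n) (θ : ℝ) :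
    binomialLowerTail n x θ = 1 - binomialUpperTail n (x + 1) θ := by
  have h : ∑ k ∈ Finset.range (n + 1), (n.choose k : ℝ) * θ ^ k * (1 - θ) ^ (n - k) = 1 := by
    have := add_pow θ (1 - θ) n
    rw [add_sub_cancel, one_pow] at this
    refine Eq.trans ?_ this.symm
    exact Finset.sum_congr rfl fun k _ => by ring
  rw [← Finset.sum_range_add_sum_Ico _ (show x + 1 ≤ n + 1 by omega)] at h
  rw [binomialLowerTail, binomialUpperTail, ← Finset.Ico_add_one_right_eq_Icc]
  linarith

lemma existsUnique_binomialLowerTail_eq (n x : ℕ) (hxn : x < n) (c : ℝ)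
    (hc : c ∈ Set.Icc (0 : ℝ) 1) :
    ∃! θ : ℝ, θ ∈ Set.Icc (0 : ℝ) 1 ∧ binomialLowerTail n x θ = c := by
  obtain ⟨θ, ⟨hθ, he⟩, hu⟩ := existsUnique_binomialUpperTail_eq n (x + 1) (by omega)
    (by omega) (1 - c) ⟨by linarith [hc.2], by linarith [hc.1]⟩
  refine ⟨θ, ⟨hθ, by rw [binomialLowerTail_eq n x hxn]; linarith⟩, fun t ht => hu t ⟨ht.1, ?_⟩⟩
  have := ht.2
  rw [binomialLowerTail_eq n x hxn] at this
  linarith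

lemma clopperPearsonLower_spec (n x : ℕ) (hx0 : x ≠ 0) (hxn : x ≤ n) (α : ℝ)
    (hα : α ∈ Set.Ioo (0 : ℝ) 1) :
    clopperPearsonLower n α x ∈ Set.Icc (0 : ℝ) 1 ∧
      binomialUpperTail n x (clopperPearsonLower n α x) = α / 2 := by
  obtain ⟨θ, hθ, hu⟩ := existsUnique_binomialUpperTail_eq n x hx0 hxn (α / 2)
    ⟨by linarith [hα.1], by linarith [hα.2]⟩
  have hs : {θ : ℝ | θ ∈ Set.Icc 0 1 ∧ binomialUpperTail n x θ = α / 2} = {θ} :=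
    Set.eq_singleton_iff_unique_mem.mpr ⟨hθ, fun t ht => hu t ht⟩
  rw [clopperPearsonLower, if_neg hx0, hs, csInf_singleton]
  exact hθ

lemma clopperPearsonUpper_spec (n x : ℕ) (hxn : x < n) (α : ℝ)
    (hα : α ∈ Set.Ioo (0 : ℝ) 1) :
    clopperPearsonUpper n α x ∈ Set.Icc (0 : ℝ) 1 ∧
      binomialLowerTail n x (clopperPearsonUpper n α x) = α / 2 := by
  obtain ⟨θ, hθ, hu⟩ := existsUnique_binomialLowerTail_eq n x hxn (α / 2)
    ⟨by linarith [hα.1], by linarith [hα.2]⟩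
  have hs : {θ : ℝ | θ ∈ Set.Icc 0 1 ∧ binomialLowerTail n x θ = α / 2} = {θ} :=
    Set.eq_singleton_iff_unique_mem.mpr ⟨hθ, fun t ht => hu t ht⟩
  rw [clopperPearsonUpper, if_neg hxn.ne, hs, csInf_singleton]
  exact hθ

/-! The lower end point at x is the α/2 quantile of the beta distribution with parameters x and n -
x + 1. Put r = x/n and ε = n^(-1/2). For r in a compact subset of (0, 1), this quantile is compared
with the Cornish–Fisher polynomial `cfT r ε u` at u = -z. The coefficients are such that the beta
density, pulled back along `cfT`, is a constant times the normal density φ(u), up to a relative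
error ε³ times a power of 1 + |u| (`cf_residual`, `hasDerivAt_logKernel`). The constant needs no
Stirling formula: both distribution functions run from nearly 0 to nearly 1 over |u| ≤ log n, which
forces it to be near 1 (`abs_sub_stdNormalCDF_le`). So the beta distribution function at `cfT r ε u`
is Φ(u) + O(ε³). As `cfT` has slope O(ε) in u, inversion gives the end point up to O(ε⁴) = O(n⁻²),
uniformly in r (`exists_abs_clopperPearsonLower_sub_le`).

Reflection x ↦ n - x yields the upper end point, and the length at r becomes 2zεσ(r) + ε² + ε³g(r) +
O(ε⁴), where σ is `bsd` and g is `lengthCoeff z` (`one_sub_cfT_sub_cfT`).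

It remains to average over d = X/n - p, which has mean 0, variance pq/n, and third and fourth
moments O(n⁻²). A cubic Taylor polynomial for σ and a Lipschitz bound for g suffice. The term
-d²/(8σ³) of σ(p + d) is the only one that changes the result: it turns the 2 in g(p) into -5/2.
Values of X/n far from p are absorbed by d⁴, because the length is bounded. -/

open ProbabilityTheory MeasureTheory Filter

/-! ### Cornish–Fisher polynomial and its residual -/

/-- Cornish–Fisher coefficient of `ε ^ 2 * u ^ 2`, for the beta distribution with parameters
`n * r` and `n * (1 - r) + 1`, where `ε = n ^ (-1/2)`. -/
noncomputable def cfA (r : ℝ) : ℝ := (1 - 2 * r) / 3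

/-- Cornish–Fisher coefficient of `ε ^ 2`. -/
noncomputable def cfB (r : ℝ) : ℝ := -(1 + r) / 3

/-- Cornish–Fisher coefficient of `ε ^ 3 * u ^ 3`, divided by the standard deviation. -/
noncomputable def cfC (r : ℝ) : ℝ := (1 - 13 * (r * (1 - r))) / 36 / (r * (1 - r))

/-- Cornish–Fisher coefficient of `ε ^ 3 * u`, divided by the standard deviation. -/
noncomputable def cfD (r : ℝ) : ℝ :=
  (2 * cfA r * cfB r - cfA r * (1 - r) + (1 - r) ^ 2 / 2 + (1 - 13 * (r * (1 - r))) / 12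
    - 2 * cfA r ^ 2) / (r * (1 - r))

/-- Binomial standard deviation. -/
noncomputable def bsd (r : ℝ) : ℝ := √(r * (1 - r))

/-- The correction terms of orders `ε ^ 2` and `ε ^ 3`, divided by `ε ^ 2`. -/
noncomputable def cfE (r ε u : ℝ) : ℝ :=
  (cfA r * u ^ 2 + cfB r) + ε * (bsd r * (cfC r * u ^ 3 + cfD r * u))

/-- Derivative of `cfE` in `u`. -/
noncomputable def cfE' (r ε u : ℝ) : ℝ :=
  2 * cfA r * u + ε * (bsd r * (3 * cfC r * u ^ 2 + cfD r))

/-- Second derivative of `cfE` in `u`. -/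
noncomputable def cfE'' (r ε u : ℝ) : ℝ :=
  2 * cfA r + ε * (bsd r * (6 * cfC r * u))

/-- The rescaled deviation of the quantile from `r`. -/
noncomputable def cfW (r ε u : ℝ) : ℝ := bsd r * u + ε * cfE r ε u

/-- Derivative of `cfW` in `u`. -/
noncomputable def cfW' (r ε u : ℝ) : ℝ := bsd r + ε * cfE' r ε u

/-- Third-order Cornish–Fisher approximation of the beta quantile at normal level `u`. -/
noncomputable def cfT (r ε u : ℝ) : ℝ := r + ε * cfW r ε u

/-- Residual of the Cornish–Fisher approximation in the log-density equation, divided by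
`ε ^ 3`; see `cf_residual`. -/
noncomputable def cfQ (r ε u : ℝ) : ℝ :=
  let σ := bsd r
  let s := 1 - 2 * r
  let B := cfA r * u ^ 2 + cfB r
  let B1 := 2 * cfA r * u
  let D := σ * (cfC r * u ^ 3 + cfD r * u)
  let D1 := σ * (3 * cfC r * u ^ 2 + cfD r)
  let D2 := σ * (6 * cfC r * u)
  let E := cfE r ε u
  let E1 := cfE' r ε u
  let E2 := cfE'' r ε u
  (-(σ * u * (2 * B1 * D1 + ε * D1 ^ 2)) - 2 * σ * (B * D1 + D * B1 + ε * D * D1)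
      - 2 * σ * D1 * (1 - r) + σ * u * D2 * s + σ * D * s * u + σ * u * D1 * s * u)
    + (-(E * E1 ^ 2) - E1 ^ 2 * (1 - r) + 2 * (σ * u) * σ * E1 + σ ^ 2 * E + E * E2 * s
      - (σ * u) ^ 2 * E2 + E * E1 * s * u - 2 * (σ * u) * σ * E * u - (σ * u) ^ 2 * E1 * u)
    + ε * (σ * u * E1 ^ 2 + 2 * σ * E * E1 - 2 * (σ * u) * E * E2 - σ * E ^ 2 * u
      - 2 * (σ * u) * E * E1 * u)
    + ε ^ 2 * (E * E1 ^ 2 - E ^ 2 * E2 - E ^ 2 * E1 * u)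

lemma bsd_sq {r : ℝ} (h0 : 0 < r) (h1 : r < 1) : bsd r ^ 2 = r * (1 - r) :=
  Real.sq_sqrt (mul_pos h0 (by linarith)).le

/-- The left side is the u-derivative of `logKernel` after clearing the denominator T(1 - T)W', with
ε(y - mT) rewritten by `mul_sub_cfT_eq`. The four coefficients are chosen to cancel every order
below ε³. -/
lemma cf_residual {r : ℝ} (h0 : 0 < r) (h1 : r < 1) (ε u : ℝ) :
    -(cfW r ε u * cfW' r ε u ^ 2) - ε * (1 - cfT r ε u) * cfW' r ε u ^ 2
      + (ε * cfE'' r ε u + u * cfW' r ε u) * (cfT r ε u * (1 - cfT r ε u))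
      = ε ^ 3 * cfQ r ε u := by
  have hv := bsd_sq h0 h1
  have hne : r * (1 - r) ≠ 0 := (mul_pos h0 (by linarith)).ne'
  have hC : cfC r * bsd r ^ 2 = (1 - 13 * bsd r ^ 2) / 36 := by
    rw [hv, cfC, div_mul_cancel₀ _ hne]
  have hD : cfD r * bsd r ^ 2 = 2 * cfA r * cfB r - cfA r * (1 - r) + (1 - r) ^ 2 / 2
      + (1 - 13 * bsd r ^ 2) / 12 - 2 * cfA r ^ 2 := by
    rw [hv, cfD, div_mul_cancel₀ _ hne]
  have hA : cfA r = (1 - 2 * r) / 3 := rfl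
  have hB : cfB r = -(1 + r) / 3 := rfl
  simp only [cfT, cfW, cfW', cfQ, cfE, cfE', cfE'']
  generalize bsd r = σ at *
  generalize cfA r = a at *
  generalize cfB r = b at *
  generalize cfC r = c at *
  generalize cfD r = d at *
  subst hA hB
  -- Vanishing of the orders 1, ε and ε². In `e2` some factors r(1 - r) are replaced by σ², which
  -- `e3` corrects.
  have e0 : -(σ * u * σ ^ 2) + u * σ * (r * (1 - r)) = 0 := by rw [← hv]; ring
  have e1 : -(2 * (σ * u) * σ * (2 * ((1 - 2 * r) / 3) * u))
      - σ ^ 2 * (((1 - 2 * r) / 3) * u ^ 2 + -(1 + r) / 3) - σ ^ 2 * (1 - r)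
      + 2 * ((1 - 2 * r) / 3) * (r * (1 - r)) + σ * u * σ * (1 - 2 * r) * u
      + 2 * ((1 - 2 * r) / 3) * u * u * (r * (1 - r)) = 0 := by rw [← hv]; ring
  have e2 : σ * (-(2 * σ ^ 2 * u * (3 * c * u ^ 2 + d)) - u * (2 * ((1 - 2 * r) / 3) * u) ^ 2
      - 2 * (((1 - 2 * r) / 3) * u ^ 2 + -(1 + r) / 3) * (2 * ((1 - 2 * r) / 3) * u)
      - σ ^ 2 * (c * u ^ 3 + d * u) - 2 * (2 * ((1 - 2 * r) / 3) * u) * (1 - r)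
      + u * σ ^ 2 + u * (2 * ((1 - 2 * r) / 3)) * (1 - 2 * r) + 6 * c * u * σ ^ 2
      + (((1 - 2 * r) / 3) * u ^ 2 + -(1 + r) / 3) * (1 - 2 * r) * u - u ^ 3 * σ ^ 2
      + u * (2 * ((1 - 2 * r) / 3) * u) * (1 - 2 * r) * u + (3 * c * u ^ 2 + d) * u * σ ^ 2) = 0 := by
    -- The u³ part determines cσ², and the u part then determines dσ².
    have : (-(4 * u ^ 3) + 6 * u) * (c * σ ^ 2) - 2 * u * (d * σ ^ 2)
      + (- u * (2 * ((1 - 2 * r) / 3) * u) ^ 2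
      - 2 * (((1 - 2 * r) / 3) * u ^ 2 + -(1 + r) / 3) * (2 * ((1 - 2 * r) / 3) * u)
      - 2 * (2 * ((1 - 2 * r) / 3) * u) * (1 - r)
      + u * σ ^ 2 + u * (2 * ((1 - 2 * r) / 3)) * (1 - 2 * r)
      + (((1 - 2 * r) / 3) * u ^ 2 + -(1 + r) / 3) * (1 - 2 * r) * u - u ^ 3 * σ ^ 2
      + u * (2 * ((1 - 2 * r) / 3) * u) * (1 - 2 * r) * u) = 0 := by
      rw [hC, hD, hv]; ring
    linear_combination σ * this
  have e3 : σ * (6 * c * u + (3 * c * u ^ 2 + d) * u) * (r * (1 - r) - σ ^ 2) = 0 := by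
    rw [hv]; ring
  linear_combination e0 + ε * e1 + ε ^ 2 * e2 + ε ^ 2 * e3

lemma hasDerivAt_cfW (r ε u : ℝ) : HasDerivAt (cfW r ε) (cfW' r ε u) u := by
  have h := ((hasDerivAt_id u).const_mul (bsd r)).add
    (((((hasDerivAt_pow 2 u).const_mul (cfA r)).add_const (cfB r)).add
      (((((hasDerivAt_pow 3 u).const_mul (cfC r)).add
        ((hasDerivAt_id u).const_mul (cfD r))).const_mul (bsd r)).const_mul ε)).const_mul ε)
  refine (h.congr_deriv ?_).congr_of_eventuallyEq (Filter.Eventually.of_forall fun v => ?_)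
  · simp only [cfW', cfE']; push_cast; ring
  · simp [cfW, cfE]

lemma hasDerivAt_cfW' (r ε u : ℝ) : HasDerivAt (cfW' r ε) (ε * cfE'' r ε u) u := by
  have h := ((((hasDerivAt_id u).const_mul (2 * cfA r)).add
      (((((hasDerivAt_pow 2 u).const_mul (3 * cfC r)).add_const
        (cfD r)).const_mul (bsd r)).const_mul ε)).const_mul ε).const_add (bsd r)
  refine (h.congr_deriv ?_).congr_of_eventuallyEq (Filter.Eventually.of_forall fun v => ?_)
  · simp only [cfE'']; push_cast; ring
  · simp [cfW', cfE']

lemma hasDerivAt_cfT (r ε u : ℝ) : HasDerivAt (cfT r ε) (ε * cfW' r ε u) u :=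
  ((hasDerivAt_cfW r ε u).const_mul ε).const_add r

/-! ### Uniform polynomial bounds for the correction terms -/

/-- Polynomial growth in `u`, uniformly for `r ∈ [a, 1 - a]` and `ε ∈ [0, 1]`. -/
def PolyGrowth (a : ℝ) (f : ℝ → ℝ → ℝ → ℝ) : Prop :=
  ∃ C : ℝ, ∃ k : ℕ, 0 ≤ C ∧ ∀ r ∈ Set.Icc a (1 - a), ∀ ε ∈ Set.Icc (0 : ℝ) 1, ∀ u : ℝ,
    |f r ε u| ≤ C * (1 + |u|) ^ k

namespace PolyGrowth

variable {a : ℝ} {f g : ℝ → ℝ → ℝ → ℝ}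

lemma add (hf : PolyGrowth a f) (hg : PolyGrowth a g) :
    PolyGrowth a (fun r ε u => f r ε u + g r ε u) := by
  obtain ⟨C, k, hC, h⟩ := hf
  obtain ⟨D, l, hD, h'⟩ := hg
  refine ⟨C + D, k + l, by positivity, fun r hr ε hε u => ?_⟩
  have h1 : (1 : ℝ) ≤ 1 + |u| := by linarith [abs_nonneg u]
  calc |f r ε u + g r ε u| ≤ |f r ε u| + |g r ε u| := abs_add_le _ _
    _ ≤ C * (1 + |u|) ^ k + D * (1 + |u|) ^ l := add_le_add (h r hr ε hε u) (h' r hr ε hε u)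
    _ ≤ C * (1 + |u|) ^ (k + l) + D * (1 + |u|) ^ (k + l) := by gcongr <;> first | exact h1 | omega
    _ = _ := by ring

lemma mul (hf : PolyGrowth a f) (hg : PolyGrowth a g) :
    PolyGrowth a (fun r ε u => f r ε u * g r ε u) := by
  obtain ⟨C, k, hC, h⟩ := hf
  obtain ⟨D, l, hD, h'⟩ := hg
  refine ⟨C * D, k + l, by positivity, fun r hr ε hε u => ?_⟩
  rw [abs_mul]
  calc |f r ε u| * |g r ε u| ≤ (C * (1 + |u|) ^ k) * (D * (1 + |u|) ^ l) := by
        gcongr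
        · exact h r hr ε hε u
        · exact h' r hr ε hε u
    _ = _ := by ring

lemma neg (hf : PolyGrowth a f) : PolyGrowth a (fun r ε u => -f r ε u) := by
  obtain ⟨C, k, hC, h⟩ := hf
  exact ⟨C, k, hC, fun r hr ε hε u => by rw [abs_neg]; exact h r hr ε hε u⟩

lemma sub (hf : PolyGrowth a f) (hg : PolyGrowth a g) :
    PolyGrowth a (fun r ε u => f r ε u - g r ε u) := by
  simpa [sub_eq_add_neg] using hf.add hg.neg

lemma of_bound (C : ℝ) (h : ∀ r ∈ Set.Icc a (1 - a), ∀ ε ∈ Set.Icc (0 : ℝ) 1, ∀ u : ℝ,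
    |f r ε u| ≤ C) : PolyGrowth a f :=
  ⟨max C 0, 0, le_max_right _ _, fun r hr ε hε u => by
    simpa using Or.inl (h r hr ε hε u)⟩

lemma const (c : ℝ) : PolyGrowth a (fun _ _ _ => c) := of_bound |c| fun _ _ _ _ _ => le_rfl

lemma pow (hf : PolyGrowth a f) (m : ℕ) : PolyGrowth a (fun r ε u => f r ε u ^ m) := by
  induction m with
  | zero => simpa using const 1
  | succ m ih => simpa [pow_succ] using ih.mul hf

lemma var : PolyGrowth a (fun _ _ u => u) :=
  ⟨1, 1, zero_le_one, fun _ _ _ _ u => by simp⟩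

lemma small : PolyGrowth a (fun _ ε _ => ε) :=
  of_bound 1 fun _ _ ε hε _ => by rw [abs_of_nonneg hε.1]; exact hε.2

lemma ratio (ha : 0 < a) : PolyGrowth a (fun r _ _ => r) :=
  of_bound 1 fun r hr _ _ _ => by
    rw [abs_of_nonneg (ha.le.trans hr.1)]; linarith [hr.2]

end PolyGrowth

lemma le_bsd {a r : ℝ} (ha : 0 < a) (ha' : a ≤ 1 / 2) (hr : r ∈ Set.Icc a (1 - a)) :
    a ≤ bsd r := by
  refine Real.le_sqrt_of_sq_le ?_
  nlinarith [hr.1, hr.2, mul_nonneg (sub_nonneg.2 hr.1) (sub_nonneg.2 hr.2)]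

lemma bsd_le_one (r : ℝ) : bsd r ≤ 1 := by
  refine Real.sqrt_le_one.mpr ?_
  nlinarith [sq_nonneg (r - 1 / 2)]

lemma bsd_nonneg (r : ℝ) : 0 ≤ bsd r := Real.sqrt_nonneg _

lemma polyGrowth_bsd (a : ℝ) : PolyGrowth a (fun r _ _ => bsd r) :=
  .of_bound 1 fun r _ _ _ _ => by
    rw [abs_of_nonneg (bsd_nonneg r)]; exact bsd_le_one r

lemma polyGrowth_cfA {a : ℝ} (ha : 0 < a) : PolyGrowth a (fun r _ _ => cfA r) := by
  simp only [cfA, div_eq_mul_inv]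
  exact ((PolyGrowth.const 1).sub ((PolyGrowth.const 2).mul (.ratio ha))).mul (.const _)

lemma polyGrowth_cfB {a : ℝ} (ha : 0 < a) : PolyGrowth a (fun r _ _ => cfB r) := by
  simp only [cfB, div_eq_mul_inv]
  exact ((PolyGrowth.const 1).add (.ratio ha)).neg.mul (.const _)

lemma polyGrowth_variance_inv {a : ℝ} (ha : 0 < a) : PolyGrowth a (fun r _ _ => (r * (1 - r))⁻¹) := by
  refine .of_bound ((a * a)⁻¹) fun r hr _ _ _ => ?_
  have h : a * a ≤ r * (1 - r) := mul_le_mul hr.1 (by linarith [hr.2]) ha.le (ha.le.trans hr.1)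
  have h2 : 0 < a * a := mul_pos ha ha
  rw [abs_of_pos (inv_pos.2 (h2.trans_le h))]
  exact inv_anti₀ h2 h

lemma polyGrowth_one_sub {a : ℝ} (ha : 0 < a) : PolyGrowth a (fun r _ _ => 1 - r) :=
  (PolyGrowth.const 1).sub (.ratio ha)

lemma polyGrowth_cfC {a : ℝ} (ha : 0 < a) : PolyGrowth a (fun r _ _ => cfC r) := by
  simp only [cfC, div_eq_mul_inv (_ / _)]
  simp only [div_eq_mul_inv _ (36 : ℝ)]
  exact (((PolyGrowth.const 1).sub ((PolyGrowth.const 13).mul ((PolyGrowth.ratio ha).mul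
    (polyGrowth_one_sub ha)))).mul (.const _)).mul (polyGrowth_variance_inv ha)

lemma polyGrowth_cfD {a : ℝ} (ha : 0 < a) : PolyGrowth a (fun r _ _ => cfD r) := by
  have hA := polyGrowth_cfA ha
  have hB := polyGrowth_cfB ha
  have h1 := polyGrowth_one_sub ha
  have hr := PolyGrowth.ratio ha
  have hi := polyGrowth_variance_inv ha
  simp only [cfD, div_eq_mul_inv]
  repeat' first
    | assumption
    | with_reducible exact PolyGrowth.const _
    | with_reducible apply PolyGrowth.mul
    | with_reducible apply PolyGrowth.add
    | with_reducible apply PolyGrowth.sub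
    | with_reducible apply PolyGrowth.pow

lemma polyGrowth_cfE {a : ℝ} (ha : 0 < a) : PolyGrowth a cfE := by
  have hA := polyGrowth_cfA ha
  have hB := polyGrowth_cfB ha
  have hC := polyGrowth_cfC ha
  have hD := polyGrowth_cfD ha
  have hs := polyGrowth_bsd a
  exact ((hA.mul (PolyGrowth.var.pow 2)).add hB).add (PolyGrowth.small.mul
    (hs.mul ((hC.mul (PolyGrowth.var.pow 3)).add (hD.mul .var))))

lemma polyGrowth_cfE' {a : ℝ} (ha : 0 < a) : PolyGrowth a cfE' := by
  have hA := polyGrowth_cfA ha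
  have hC := polyGrowth_cfC ha
  have hD := polyGrowth_cfD ha
  have hs := polyGrowth_bsd a
  exact (((PolyGrowth.const 2).mul hA).mul .var).add (PolyGrowth.small.mul
    (hs.mul ((((PolyGrowth.const 3).mul hC).mul (PolyGrowth.var.pow 2)).add hD)))

lemma polyGrowth_cfE'' {a : ℝ} (ha : 0 < a) : PolyGrowth a cfE'' := by
  have hA := polyGrowth_cfA ha
  have hC := polyGrowth_cfC ha
  have hs := polyGrowth_bsd a
  exact ((PolyGrowth.const 2).mul hA).add (PolyGrowth.small.mul
    (hs.mul (((PolyGrowth.const 6).mul hC).mul PolyGrowth.var)))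

lemma polyGrowth_cfQ {a : ℝ} (ha : 0 < a) : PolyGrowth a cfQ := by
  have hA := polyGrowth_cfA ha
  have hB := polyGrowth_cfB ha
  have hC := polyGrowth_cfC ha
  have hD := polyGrowth_cfD ha
  have hs := polyGrowth_bsd a
  have hE := polyGrowth_cfE ha
  have hE1 := polyGrowth_cfE' ha
  have hE2 := polyGrowth_cfE'' ha
  have hr := PolyGrowth.ratio ha
  have h1 := polyGrowth_one_sub ha
  have hu := PolyGrowth.var (a := a)
  have he := PolyGrowth.small (a := a)
  unfold cfQ
  dsimp only
  repeat' first
    | assumption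
    | with_reducible exact PolyGrowth.const _
    | with_reducible apply PolyGrowth.mul
    | with_reducible apply PolyGrowth.add
    | with_reducible apply PolyGrowth.sub
    | with_reducible apply PolyGrowth.neg
    | with_reducible apply PolyGrowth.pow

/-! ### Standard normal distribution -/

/-- The standard normal distribution function. -/
noncomputable def stdNormalCDF (x : ℝ) : ℝ := cdf (gaussianReal 0 1) x

/-- The standard normal density. -/
noncomputable def stdNormalPDF (x : ℝ) : ℝ := (√(2 * Real.pi))⁻¹ * Real.exp (-(x ^ 2 / 2))

lemma stdNormalPDF_eq : stdNormalPDF = gaussianPDFReal 0 1 := by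
  funext x
  simp [stdNormalPDF, gaussianPDFReal, neg_div]

lemma stdNormalPDF_pos (x : ℝ) : 0 < stdNormalPDF x := by
  unfold stdNormalPDF; positivity

lemma stdNormalPDF_neg (x : ℝ) : stdNormalPDF (-x) = stdNormalPDF x := by
  simp [stdNormalPDF]

lemma stdNormalPDF_continuous : Continuous stdNormalPDF := by
  unfold stdNormalPDF; fun_prop

lemma stdNormalCDF_eq_integral (x : ℝ) :
    stdNormalCDF x = ∫ t in Set.Iic x, stdNormalPDF t := by
  rw [stdNormalCDF, cdf_eq_real, measureReal_def,
    gaussianReal_apply_eq_integral 0 one_ne_zero, stdNormalPDF_eq, ENNReal.toReal_ofReal]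
  exact integral_nonneg fun _ => gaussianPDFReal_nonneg _ _ _

lemma integrable_stdNormalPDF : Integrable stdNormalPDF := by
  rw [stdNormalPDF_eq]; exact integrable_gaussianPDFReal 0 1

lemma hasDerivAt_stdNormalCDF (x : ℝ) : HasDerivAt stdNormalCDF (stdNormalPDF x) x := by
  have h : ∀ y, stdNormalCDF y = stdNormalCDF 0 + ∫ t in (0 : ℝ)..y, stdNormalPDF t := by
    intro y
    rw [stdNormalCDF_eq_integral, stdNormalCDF_eq_integral,
      ← intervalIntegral.integral_Iic_sub_Iic integrable_stdNormalPDF.integrableOn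
        integrable_stdNormalPDF.integrableOn]
    ring
  have h' : stdNormalCDF = fun y => stdNormalCDF 0 + ∫ t in (0 : ℝ)..y, stdNormalPDF t :=
    funext h
  rw [h']
  exact ((stdNormalPDF_continuous.integral_hasStrictDerivAt 0 x).hasDerivAt).const_add _

lemma stdNormalCDF_strictMono : StrictMono stdNormalCDF :=
  strictMono_of_deriv_pos fun x => by
    rw [(hasDerivAt_stdNormalCDF x).deriv]; exact stdNormalPDF_pos x

lemma stdNormalCDF_continuous : Continuous stdNormalCDF :=
  continuous_iff_continuousAt.2 fun x => (hasDerivAt_stdNormalCDF x).continuousAt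

lemma stdNormalCDF_neg (x : ℝ) : stdNormalCDF (-x) = 1 - stdNormalCDF x := by
  have h1 : stdNormalCDF (-x) = ∫ t in Set.Ioi x, stdNormalPDF t := by
    rw [stdNormalCDF_eq_integral, ← integral_comp_neg_Ioi]
    simp [stdNormalPDF_neg]
  have h2 : ∫ t, stdNormalPDF t = 1 := by
    rw [stdNormalPDF_eq]; exact integral_gaussianPDFReal_eq_one 0 one_ne_zero
  rw [h1, stdNormalCDF_eq_integral, ← h2,
    ← intervalIntegral.integral_Iic_add_Ioi (b := x) integrable_stdNormalPDF.integrableOn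
        integrable_stdNormalPDF.integrableOn]
  ring

lemma stdNormalCDF_nonneg (x : ℝ) : 0 ≤ stdNormalCDF x := cdf_nonneg _ _

lemma stdNormalCDF_le_one (x : ℝ) : stdNormalCDF x ≤ 1 := cdf_le_one _ _

/-- Chernoff bound with the optimal exponent -M. -/
lemma stdNormalCDF_neg_le {M : ℝ} (hM : 0 ≤ M) : stdNormalCDF (-M) ≤ Real.exp (-(M ^ 2 / 2)) := by
  have h := measure_le_le_exp_mul_mgf (μ := gaussianReal 0 1) (X := id) (t := -M) (-M) (by linarith)
    (by simpa using integrable_exp_mul_gaussianReal (-M))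
  rw [stdNormalCDF, cdf_eq_real]
  refine (le_of_eq_of_le ?_ h).trans (le_of_eq ?_)
  · rfl
  · rw [mgf_id_gaussianReal, ← Real.exp_add]
    congr 1
    simp
    ring

lemma exists_stdNormalCDF_eq {c : ℝ} (h0 : 0 < c) (h1 : c < 1) : ∃ x, stdNormalCDF x = c := by
  have hb := (tendsto_cdf_atBot (gaussianReal 0 1)).eventually_lt_const h0
  have ht := (tendsto_cdf_atTop (gaussianReal 0 1)).eventually_const_lt h1
  obtain ⟨x, hx⟩ := hb.exists
  obtain ⟨y, hy⟩ := ht.exists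
  exact mem_range_of_exists_le_of_exists_ge stdNormalCDF_continuous ⟨x, hx.le⟩ ⟨y, hy.le⟩

lemma stdNormalCDF_neg_upperQuantile {β : ℝ} (h0 : 0 < β) (h1 : β < 1) :
    stdNormalCDF (-stdNormalUpperQuantile β) = β := by
  obtain ⟨x, hx⟩ := exists_stdNormalCDF_eq (c := 1 - β) (by linarith) (by linarith)
  have : {y : ℝ | 1 - β ≤ cdf (gaussianReal 0 1) y} = Set.Ici x := by
    ext y
    change 1 - β ≤ stdNormalCDF y ↔ x ≤ y
    rw [← hx, stdNormalCDF_strictMono.le_iff_le]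
  rw [stdNormalUpperQuantile, this, csInf_Ici, stdNormalCDF_neg, hx]
  ring

lemma stdNormalPDF_le_exp (u : ℝ) : stdNormalPDF u ≤ Real.exp (-(u ^ 2 / 2)) := by
  unfold stdNormalPDF
  refine mul_le_of_le_one_left (Real.exp_pos _).le (inv_le_one_of_one_le₀ ?_)
  rw [Real.one_le_sqrt]
  linarith [Real.pi_gt_three]

/-- The normal density beats every polynomial. -/
lemma exists_stdNormalPDF_mul_pow_le (k : ℕ) :
    ∃ C : ℝ, 0 ≤ C ∧ ∀ u : ℝ, stdNormalPDF u * (1 + |u|) ^ k ≤ C * (1 / (1 + u ^ 2)) := by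
  -- From x^N/N! ≤ e^x with x = 1 + |u| and N = k + 2, where two powers pay for 1 + u², and from
  -- -u²/2 + 1 + |u| ≤ 3/2.
  refine ⟨(k + 2).factorial * Real.exp (3 / 2), by positivity, fun u => ?_⟩
  have h1 : (0 : ℝ) < 1 + |u| := by linarith [abs_nonneg u]
  have h2 : (1 + |u|) ^ (k + 2) ≤ (k + 2).factorial * Real.exp (1 + |u|) := by
    have := Real.pow_div_factorial_le_exp (1 + |u|) h1.le (k + 2)
    rwa [div_le_iff₀ (by positivity), mul_comm] at this
  have h3 := stdNormalPDF_le_exp u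
  have h4 : (1 + u ^ 2) ≤ (1 + |u|) ^ 2 := by nlinarith [abs_nonneg u, sq_abs u]
  have h5 : Real.exp (-(u ^ 2 / 2)) * Real.exp (1 + |u|) ≤ Real.exp (3 / 2) := by
    rw [← Real.exp_add, Real.exp_le_exp]
    nlinarith [sq_nonneg (|u| - 1), sq_abs u]
  rw [mul_one_div, le_div_iff₀ (by positivity)]
  calc stdNormalPDF u * (1 + |u|) ^ k * (1 + u ^ 2)
      ≤ Real.exp (-(u ^ 2 / 2)) * (1 + |u|) ^ k * (1 + |u|) ^ 2 := by gcongr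
    _ = Real.exp (-(u ^ 2 / 2)) * (1 + |u|) ^ (k + 2) := by ring
    _ ≤ Real.exp (-(u ^ 2 / 2)) * ((k + 2).factorial * Real.exp (1 + |u|)) := by gcongr
    _ = (k + 2).factorial * (Real.exp (-(u ^ 2 / 2)) * Real.exp (1 + |u|)) := by ring
    _ ≤ (k + 2).factorial * (Real.exp (3 / 2)) := by gcongr

/-! ### Beta density: unimodality and tails -/

/-- The kernel of a beta density is unimodal. -/
lemma pow_mul_pow_le_of_unimodal (y m : ℕ) (hy : y ≤ m) {s t : ℝ} (hs0 : 0 < s) (hs1 : s < 1)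
    (ht0 : 0 ≤ t) (ht1 : t ≤ 1) (h : (t - s) * (y - m * s) ≤ 0) :
    t ^ y * (1 - t) ^ (m - y) ≤ s ^ y * (1 - s) ^ (m - y) := by
  have hs1' : 0 < 1 - s := by linarith
  -- By 1 + w ≤ e^w in both factors, the ratio of kernels is at most exp((t - s)(y - ms)/(s(1 -
  -- s))). The sign hypothesis says, without dividing by m, that s is no farther along than the mode
  -- when coming from t.
  have h1 : (t / s) ^ y ≤ Real.exp (y * (t / s - 1)) := by
    rw [Real.exp_nat_mul]
    exact pow_le_pow_left₀ (by positivity) (by linarith [Real.add_one_le_exp (t / s - 1)]) _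
  have h2 : ((1 - t) / (1 - s)) ^ (m - y)
      ≤ Real.exp ((m - y : ℕ) * ((1 - t) / (1 - s) - 1)) := by
    rw [Real.exp_nat_mul]
    exact pow_le_pow_left₀ (div_nonneg (by linarith) hs1'.le)
      (by linarith [Real.add_one_le_exp ((1 - t) / (1 - s) - 1)]) _
  have h3 : (t / s) ^ y * ((1 - t) / (1 - s)) ^ (m - y) ≤ 1 := by
    calc _ ≤ Real.exp (y * (t / s - 1)) * Real.exp ((m - y : ℕ) * ((1 - t) / (1 - s) - 1)) := by
          gcongr
      _ = Real.exp (((t - s) * (y - m * s)) / (s * (1 - s))) := by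
          rw [← Real.exp_add, Nat.cast_sub hy]
          congr 1
          field_simp
          ring
      _ ≤ 1 := by
          rw [Real.exp_le_one_iff]
          exact div_nonpos_of_nonpos_of_nonneg h (by positivity)
  rw [div_pow, div_pow, div_mul_div_comm, div_le_one (by positivity)] at h3
  exact h3

/-- The density of the beta distribution with parameters `y + 1` and `m - y + 1`. -/
noncomputable def betaDensity (m y : ℕ) (t : ℝ) : ℝ :=
  ((m : ℝ) + 1) * ((m.choose y : ℝ) * t ^ y * (1 - t) ^ (m - y))

lemma betaDensity_le_of_unimodal (y m : ℕ) (hy : y ≤ m) {s t : ℝ} (hs0 : 0 < s) (hs1 : s < 1)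
    (ht0 : 0 ≤ t) (ht1 : t ≤ 1) (h : (t - s) * (y - m * s) ≤ 0) :
    betaDensity m y t ≤ betaDensity m y s := by
  unfold betaDensity
  simp only [mul_assoc]
  gcongr (_ * (_ * ?_))
  exact pow_mul_pow_le_of_unimodal y m hy hs0 hs1 ht0 ht1 h

lemma betaDensity_nonneg (m y : ℕ) {t : ℝ} (ht0 : 0 ≤ t) (ht1 : t ≤ 1) :
    0 ≤ betaDensity m y t := by
  have : 0 ≤ 1 - t := by linarith
  unfold betaDensity; positivity

/-- Below the mode the density increases, so the mass of [0, s] is at most s times the density at s,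
and s ≤ 1. Losing the factor s is harmless where the density is already tiny. -/
lemma binomialUpperTail_le_betaDensity (y m : ℕ) (hy : y ≤ m) {s : ℝ} (hs0 : 0 < s) (hs1 : s < 1)
    (h : m * s ≤ y) : binomialUpperTail (m + 1) (y + 1) s ≤ betaDensity m y s := by
  have := Convex.image_sub_le_mul_sub_of_deriv_le (convex_Icc 0 s)
    (f := binomialUpperTail (m + 1) (y + 1)) (C := betaDensity m y s)
    (binomialUpperTail_continuous _ _).continuousOn
    (fun t _ => (binomialUpperTail_hasDerivAt m y hy t).differentiableAt.differentiableWithinAt)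
    (fun t ht => by
      rw [interior_Icc] at ht
      rw [(binomialUpperTail_hasDerivAt m y hy t).deriv]
      exact betaDensity_le_of_unimodal y m hy hs0 hs1 ht.1.le (by linarith [ht.2])
        (mul_nonpos_of_nonpos_of_nonneg (by linarith [ht.2]) (by linarith)))
    0 (Set.left_mem_Icc.2 hs0.le) s (Set.right_mem_Icc.2 hs0.le) hs0.le
  rw [binomialUpperTail_zero _ _ (by omega)] at this
  have h0 := betaDensity_nonneg m y hs0.le hs1.le
  nlinarith

lemma one_sub_binomialUpperTail_le_betaDensity (y m : ℕ) (hy : y ≤ m) {s : ℝ} (hs0 : 0 < s)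
    (hs1 : s < 1) (h : y ≤ m * s) :
    1 - binomialUpperTail (m + 1) (y + 1) s ≤ betaDensity m y s := by
  have := Convex.image_sub_le_mul_sub_of_deriv_le (convex_Icc s 1)
    (f := binomialUpperTail (m + 1) (y + 1)) (C := betaDensity m y s)
    (binomialUpperTail_continuous _ _).continuousOn
    (fun t _ => (binomialUpperTail_hasDerivAt m y hy t).differentiableAt.differentiableWithinAt)
    (fun t ht => by
      rw [interior_Icc] at ht
      rw [(binomialUpperTail_hasDerivAt m y hy t).deriv]
      exact betaDensity_le_of_unimodal y m hy hs0 hs1 (by linarith [ht.1]) ht.2.le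
        (mul_nonpos_of_nonneg_of_nonpos (by linarith [ht.1]) (by linarith)))
    s (Set.left_mem_Icc.2 hs1.le) 1 (Set.right_mem_Icc.2 hs1.le) hs1.le
  rw [binomialUpperTail_one _ _ (by omega)] at this
  have h0 := betaDensity_nonneg m y hs0.le hs1.le
  nlinarith

/-! ### Comparison of the beta and normal distribution functions -/

/-- A function whose derivative is close to a multiple of the normal density, and which runs from
almost `0` to almost `1`, is close to the normal distribution function. -/
lemma abs_sub_stdNormalCDF_le {F f : ℝ → ℝ} {K M δ C τ η : ℝ} {j : ℕ} (hK : 0 < K)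
    (hδ : 0 ≤ δ) (hC : 0 ≤ C)
    (hF : ∀ u ∈ Set.Icc (-M) M, HasDerivAt F (f u) u)
    (hf : ∀ u ∈ Set.Icc (-M) M, |f u - K * stdNormalPDF u| ≤ K * stdNormalPDF u * (δ * (1 + |u|) ^ j))
    (hj : ∀ u : ℝ, stdNormalPDF u * (1 + |u|) ^ j ≤ C * (1 / (1 + u ^ 2)))
    (hl0 : 0 ≤ F (-M)) (hl : F (-M) ≤ K * τ) (hu0 : F M ≤ 1) (hu : 1 - F M ≤ K * τ)
    (ht : stdNormalCDF (-M) ≤ τ) (hη : δ * C * Real.pi + 2 * τ ≤ η) (hη' : η ≤ 1 / 4)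
    {u : ℝ} (hu' : u ∈ Set.Icc (-M) M) : |F u - stdNormalCDF u| ≤ 6 * η := by
  have hτ : 0 ≤ τ := (stdNormalCDF_nonneg _).trans ht
  have hM : -M ≤ M := hu'.1.trans hu'.2
  -- The derivative of F - KΦ is dominated by that of KδC·arctan, whose increase is at most KδCπ.
  -- Errors stay relative to K, since only its positivity is known so far.
  have key : ∀ v ∈ Set.Icc (-M) M, |F v - K * stdNormalCDF v| ≤ K * η := by
    intro v hv
    have hsub : Set.Icc (-M) v ⊆ Set.Icc (-M) M := Set.Icc_subset_Icc_right hv.2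
    have hS : ∀ w ∈ Set.Icc (-M) v, HasDerivAt (fun w => F w - K * stdNormalCDF w)
        (f w - K * stdNormalPDF w) w := fun w hw =>
      (hF w (hsub hw)).sub ((hasDerivAt_stdNormalCDF w).const_mul K)
    have hA : ∀ w, HasDerivAt (fun w => K * δ * C * Real.arctan w)
        (K * δ * C * (1 / (1 + w ^ 2))) w := fun w => (Real.hasDerivAt_arctan w).const_mul _
    have hb : ∀ w ∈ Set.Icc (-M) v,
        |f w - K * stdNormalPDF w| ≤ K * δ * C * (1 / (1 + w ^ 2)) := by
      intro w hw
      refine (hf w (hsub hw)).trans ?_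
      have := mul_le_mul_of_nonneg_left (hj w) (mul_nonneg hK.le hδ)
      nlinarith
    have hmono1 : MonotoneOn (fun w => K * δ * C * Real.arctan w - (F w - K * stdNormalCDF w))
        (Set.Icc (-M) v) := by
      refine monotoneOn_of_deriv_nonneg (convex_Icc _ _) (fun w hw =>
        ((hA w).sub (hS w hw)).continuousAt.continuousWithinAt) (fun w hw =>
        ((hA w).sub (hS w (interior_subset hw))).differentiableAt.differentiableWithinAt)
        (fun w hw => ?_)
      have hw' := interior_subset hw
      refine le_of_le_of_eq ?_ ((hA w).sub (hS w hw')).deriv.symm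
      linarith [le_abs_self (f w - K * stdNormalPDF w), hb w hw']
    have hmono2 : MonotoneOn (fun w => K * δ * C * Real.arctan w + (F w - K * stdNormalCDF w))
        (Set.Icc (-M) v) := by
      refine monotoneOn_of_deriv_nonneg (convex_Icc _ _) (fun w hw =>
        ((hA w).add (hS w hw)).continuousAt.continuousWithinAt) (fun w hw =>
        ((hA w).add (hS w (interior_subset hw))).differentiableAt.differentiableWithinAt)
        (fun w hw => ?_)
      have hw' := interior_subset hw
      refine le_of_le_of_eq ?_ ((hA w).add (hS w hw')).deriv.symm
      linarith [neg_abs_le (f w - K * stdNormalPDF w), hb w hw']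
    have m1 := hmono1 (Set.left_mem_Icc.2 hv.1) (Set.right_mem_Icc.2 hv.1) hv.1
    have m2 := hmono2 (Set.left_mem_Icc.2 hv.1) (Set.right_mem_Icc.2 hv.1) hv.1
    simp only at m1 m2
    have hat : Real.arctan v - Real.arctan (-M) ≤ Real.pi := by
      linarith [Real.arctan_lt_pi_div_two v, Real.neg_pi_div_two_lt_arctan (-M)]
    have hat' := mul_le_mul_of_nonneg_left hat (mul_nonneg (mul_nonneg hK.le hδ) hC)
    have ht1 := mul_le_mul_of_nonneg_left ht hK.le
    have ht0 := mul_nonneg hK.le (stdNormalCDF_nonneg (-M))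
    have hη1 := mul_le_mul_of_nonneg_left hη hK.le
    rw [abs_le]
    have := mul_nonneg hK.le hτ
    constructor <;> nlinarith
  -- At M both F and Φ are nearly 1, so K is nearly 1.
  have hM1 := abs_le.1 (key M (Set.right_mem_Icc.2 hM))
  have hΦM : 1 - stdNormalCDF M ≤ τ := by rw [stdNormalCDF_neg] at ht; exact ht
  have hΦM' := mul_le_mul_of_nonneg_left hΦM hK.le
  have hΦ1 := mul_le_mul_of_nonneg_left (stdNormalCDF_le_one M) hK.le
  have hτη : 2 * τ ≤ η := by
    have := mul_nonneg (mul_nonneg hδ hC) Real.pi_pos.le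
    linarith
  have hτη' := mul_le_mul_of_nonneg_left hτη hK.le
  have hη4 := mul_le_mul_of_nonneg_left hη' hK.le
  have hK2 : K ≤ 2 := by linarith
  have hη0 : 0 ≤ η := by linarith
  have hKη := mul_le_mul_of_nonneg_right hK2 hη0
  have hK1 : |K - 1| ≤ 4 * η := by rw [abs_le]; constructor <;> linarith
  have hv := key u hu'
  calc |F u - stdNormalCDF u| = |(F u - K * stdNormalCDF u) + (K - 1) * stdNormalCDF u| := by
        congr 1; ring
    _ ≤ |F u - K * stdNormalCDF u| + |(K - 1) * stdNormalCDF u| := abs_add_le _ _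
    _ ≤ K * η + 4 * η * 1 := by
        rw [abs_mul, abs_of_nonneg (stdNormalCDF_nonneg u)]
        exact add_le_add hv (mul_le_mul hK1 (stdNormalCDF_le_one u) (stdNormalCDF_nonneg u)
          (by linarith))
    _ ≤ 6 * η := by linarith

/-- Logarithm of the beta kernel at `cfT r ε u`, corrected by the logarithms of the Jacobian and of
the normal kernel. -/
noncomputable def logKernel (m y : ℕ) (r ε u : ℝ) : ℝ :=
  y * Real.log (cfT r ε u) + (m - y : ℝ) * Real.log (1 - cfT r ε u) + Real.log (cfW' r ε u)
    + u ^ 2 / 2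

lemma betaDensity_mul_eq_exp_logKernel {m y : ℕ} (hy : y ≤ m) {r ε u : ℝ} (hT0 : 0 < cfT r ε u)
    (hT1 : cfT r ε u < 1) (hW : 0 < cfW' r ε u) :
    betaDensity m y (cfT r ε u) * cfW' r ε u
      = ((m : ℝ) + 1) * m.choose y * (Real.exp (logKernel m y r ε u) * Real.exp (-(u ^ 2 / 2))) := by
  have h1 : 0 < 1 - cfT r ε u := by linarith
  rw [← Real.exp_add, logKernel, add_neg_cancel_right, Real.exp_add, Real.exp_add,
    Real.exp_log hW, Real.exp_nat_mul, Real.exp_log hT0, ← Nat.cast_sub hy, Real.exp_nat_mul,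
    Real.exp_log h1, betaDensity]
  ring

/-- With n = m + 1 one has y = rn - 1 and m = n - 1; these shifts produce the term ε(1 - T). -/
lemma mul_sub_cfT_eq {m y : ℕ} {r ε : ℝ} (hε : 0 < ε) (hn : ε ^ 2 * (m + 1) = 1)
    (hry : r * (m + 1) = y + 1) (u : ℝ) :
    ε * (y - m * cfT r ε u) = -cfW r ε u - ε * (1 - cfT r ε u) := by
  refine mul_left_cancel₀ hε.ne' ?_
  have hy' : (y : ℝ) = r * (m + 1) - 1 := by linarith
  rw [hy', cfT]
  linear_combination (-ε * cfW r ε u) * hn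

/-- The factor ε³ is the purpose of the construction: the pulled-back density divided by φ is almost
constant. -/
lemma hasDerivAt_logKernel {m y : ℕ} {r ε u : ℝ} (hr0 : 0 < r) (hr1 : r < 1) (hε : 0 < ε)
    (hn : ε ^ 2 * (m + 1) = 1) (hry : r * (m + 1) = y + 1)
    (hT0 : 0 < cfT r ε u) (hT1 : cfT r ε u < 1) (hW : 0 < cfW' r ε u) :
    HasDerivAt (logKernel m y r ε)
      (ε ^ 3 * cfQ r ε u / (cfT r ε u * (1 - cfT r ε u) * cfW' r ε u)) u := by
  have h1 : 0 < 1 - cfT r ε u := by linarith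
  have hT := hasDerivAt_cfT r ε u
  have hd := ((((hT.log hT0.ne').const_mul (y : ℝ)).add
    (((hT.const_sub 1).log h1.ne').const_mul (m - y : ℝ))).add
    ((hasDerivAt_cfW' r ε u).log hW.ne')).add ((hasDerivAt_pow 2 u).div_const 2)
  refine hd.congr_deriv ?_
  have hres := cf_residual hr0 hr1 ε u
  have hcoef := mul_sub_cfT_eq hε hn hry u
  rw [eq_div_iff (by positivity), ← hres]
  have hT0' := hT0.ne'
  have h1' := h1.ne'
  have hW' := hW.ne'
  generalize cfT r ε u = T at *
  generalize cfW' r ε u = V at *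
  generalize cfE'' r ε u = E at *
  generalize cfW r ε u = W at *
  push_cast
  field_simp
  linear_combination (V ^ 2) * hcoef

section LocalExpansion

variable {a C ε M r : ℝ} {k m y : ℕ}

/-- Only ε times a power of M has to be small, so M may grow logarithmically. On this range `cfT`
avoids 0 and 1 and its slope is comparable to ε. -/
lemma cf_range (ha : 0 < a) (ha' : a ≤ 1 / 2) (hC : 1 ≤ C) (hε : 0 < ε) (hε1 : ε ≤ 1)
    (hr : r ∈ Set.Icc a (1 - a))
    (hE : ∀ u, |cfE r ε u| ≤ C * (1 + |u|) ^ k) (hE' : ∀ u, |cfE' r ε u| ≤ C * (1 + |u|) ^ k)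
    (hs : ε * (C * (1 + M) ^ (k + 1)) ≤ a / 4) {u : ℝ} (hu : |u| ≤ M) :
    |cfW r ε u - bsd r * u| ≤ a / 4 ∧ a / 2 ≤ cfT r ε u ∧ cfT r ε u ≤ 1 - a / 2 ∧
      a / 2 ≤ cfW' r ε u ∧ cfW' r ε u ≤ 2 := by
  have hu0 := abs_nonneg u
  have hM0 : 0 ≤ M := hu0.trans hu
  have hpow : (1 + |u|) ^ k ≤ (1 + M) ^ (k + 1) := by
    calc (1 + |u|) ^ k ≤ (1 + M) ^ k := by gcongr
      _ ≤ (1 + M) ^ (k + 1) := pow_le_pow_right₀ (by linarith) (by omega)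
  have hb : ∀ e : ℝ, |e| ≤ C * (1 + |u|) ^ k → |ε * e| ≤ a / 4 := by
    intro e he
    rw [abs_mul, abs_of_pos hε]
    refine le_trans ?_ hs
    gcongr
    exact he.trans (by gcongr)
  have h1 := hb _ (hE u)
  have h2 := abs_le.1 (hb _ (hE' u))
  have hW : |cfW r ε u - bsd r * u| ≤ a / 4 := by simpa [cfW] using h1
  -- The exponent k + 1 in `hs` makes it control εM even when k = 0.
  have hM1 : M ≤ C * (1 + M) ^ (k + 1) := by
    have : 1 + M ≤ (1 + M) ^ (k + 1) := le_self_pow₀ (by linarith) (by omega)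
    nlinarith
  have hεM : ε * M ≤ a / 4 := le_trans (by gcongr) hs
  have hσ := bsd_le_one r
  have hσ0 := bsd_nonneg r
  have hWu : |cfW r ε u| ≤ M + a / 4 := by
    calc |cfW r ε u| = |(cfW r ε u - bsd r * u) + bsd r * u| := by rw [sub_add_cancel]
      _ ≤ |cfW r ε u - bsd r * u| + |bsd r * u| := abs_add_le _ _
      _ ≤ a / 4 + 1 * M := by
          rw [abs_mul, abs_of_nonneg hσ0]
          gcongr
      _ = _ := by ring
  have hT : |ε * cfW r ε u| ≤ a / 2 := by
    rw [abs_mul, abs_of_pos hε]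
    calc ε * |cfW r ε u| ≤ ε * (M + a / 4) := by gcongr
      _ ≤ a / 4 + 1 * (a / 4) := by rw [mul_add]; gcongr
      _ = a / 2 := by ring
  have hT' := abs_le.1 hT
  refine ⟨hW, ?_, ?_, ?_, ?_⟩
  · simp only [cfT]; linarith [hr.1]
  · simp only [cfT]; linarith [hr.2]
  · have := le_bsd ha ha' hr
    simp only [cfW']; linarith [h2.1]
  · simp only [cfW']; linarith [h2.2]

/-- Mean value inequality. The denominator T(1 - T)W' is at least (a/2)³, whence 8/a³, and the
distance |u| costs one more power. -/
lemma abs_logKernel_sub_le (ha : 0 < a) (ha' : a ≤ 1 / 2) (hC : 1 ≤ C) (hε : 0 < ε) (hε1 : ε ≤ 1)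
    (hn : ε ^ 2 * (m + 1) = 1) (hr : r ∈ Set.Icc a (1 - a)) (hry : r * (m + 1) = y + 1)
    (hE : ∀ u, |cfE r ε u| ≤ C * (1 + |u|) ^ k) (hE' : ∀ u, |cfE' r ε u| ≤ C * (1 + |u|) ^ k)
    (hQ : ∀ u, |cfQ r ε u| ≤ C * (1 + |u|) ^ k)
    (hs : ε * (C * (1 + M) ^ (k + 1)) ≤ a / 4) {u : ℝ} (hu : |u| ≤ M) :
    |logKernel m y r ε u - logKernel m y r ε 0| ≤ 8 * C / a ^ 3 * ε ^ 3 * (1 + |u|) ^ (k + 1) := by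
  have hd : ∀ v ∈ Set.Icc (-|u|) |u|, HasDerivWithinAt (logKernel m y r ε)
      (ε ^ 3 * cfQ r ε v / (cfT r ε v * (1 - cfT r ε v) * cfW' r ε v)) (Set.Icc (-|u|) |u|) v := by
    intro v hv
    obtain ⟨-, h1, h2, h3, -⟩ := cf_range ha ha' hC hε hε1 hr hE hE' hs ((abs_le.2 hv).trans hu)
    exact (hasDerivAt_logKernel (ha.trans_le hr.1) (by linarith [hr.2]) hε hn hry
      (by linarith) (by linarith) (by linarith)).hasDerivWithinAt
  have hb : ∀ v ∈ Set.Icc (-|u|) |u|,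
      ‖ε ^ 3 * cfQ r ε v / (cfT r ε v * (1 - cfT r ε v) * cfW' r ε v)‖
        ≤ 8 * C / a ^ 3 * ε ^ 3 * (1 + |u|) ^ k := by
    intro v hv
    have hv' : |v| ≤ |u| := abs_le.2 hv
    obtain ⟨-, h1, h2, h3, -⟩ := cf_range ha ha' hC hε hε1 hr hE hE' hs (hv'.trans hu)
    have hden : a ^ 3 / 8 ≤ cfT r ε v * (1 - cfT r ε v) * cfW' r ε v := by
      calc a ^ 3 / 8 = a / 2 * (a / 2) * (a / 2) := by ring
        _ ≤ _ := mul_le_mul (mul_le_mul h1 (by linarith) (by positivity) (by linarith)) h3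
            (by positivity) (mul_nonneg (by linarith) (by linarith))
    have h0 : 0 < a ^ 3 / 8 := by positivity
    rw [Real.norm_eq_abs, abs_div, abs_of_pos (h0.trans_le hden), abs_mul,
      abs_of_pos (by positivity : 0 < ε ^ 3)]
    calc ε ^ 3 * |cfQ r ε v| / (cfT r ε v * (1 - cfT r ε v) * cfW' r ε v)
        ≤ ε ^ 3 * (C * (1 + |u|) ^ k) / (a ^ 3 / 8) := by
          gcongr
          exact (hQ v).trans (by gcongr)
      _ = _ := by field_simp
  have h0 := abs_nonneg u
  have := (convex_Icc (-|u|) |u|).norm_image_sub_le_of_norm_hasDerivWithin_le hd hb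
    (x := 0) (y := u) ⟨by linarith, h0⟩ ⟨neg_abs_le u, le_abs_self u⟩
  rw [Real.norm_eq_abs, Real.norm_eq_abs, sub_zero] at this
  refine this.trans ?_
  rw [pow_succ (1 + |u|), ← mul_assoc]
  gcongr
  linarith

lemma abs_binomialUpperTail_cfT_sub_le (ha : 0 < a) (ha' : a ≤ 1 / 2) (hC : 1 ≤ C) (hε : 0 < ε)
    (hε1 : ε ≤ a / 4) (hy : y ≤ m)
    (hn : ε ^ 2 * (m + 1) = 1) (hr : r ∈ Set.Icc a (1 - a)) (hry : r * (m + 1) = y + 1)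
    (hE : ∀ u, |cfE r ε u| ≤ C * (1 + |u|) ^ k) (hE' : ∀ u, |cfE' r ε u| ≤ C * (1 + |u|) ^ k)
    (hQ : ∀ u, |cfQ r ε u| ≤ C * (1 + |u|) ^ k) (hM : 1 ≤ M)
    (hMε : Real.exp (-(M ^ 2 / 2)) ≤ ε ^ 4)
    (hs : ε * (C * (1 + M) ^ (k + 1)) ≤ a / 4)
    (hs' : 8 * C / a ^ 3 * ε ^ 3 * (1 + M) ^ (k + 1) ≤ 1)
    {D : ℝ} (hD : 0 ≤ D)
    (hj : ∀ u : ℝ, stdNormalPDF u * (1 + |u|) ^ (k + 1) ≤ D * (1 / (1 + u ^ 2)))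
    (hη : (16 * C / a ^ 3 * D * Real.pi + 2 * (6 / a + 1)) * ε ^ 3 ≤ 1 / 4)
    {u : ℝ} (hu : |u| ≤ M) :
    |binomialUpperTail (m + 1) (y + 1) (cfT r ε u) - stdNormalCDF u|
      ≤ 6 * ((16 * C / a ^ 3 * D * Real.pi + 2 * (6 / a + 1)) * ε ^ 3) := by
  have hε1' : ε ≤ 1 := by linarith
  have hrange := fun {v : ℝ} (hv : |v| ≤ M) => cf_range ha ha' hC hε hε1' hr hE hE' hs hv
  have hlog := fun {v : ℝ} (hv : |v| ≤ M) =>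
    abs_logKernel_sub_le ha ha' hC hε hε1' hn hr hry hE hE' hQ hs hv
  -- K collects all factors independent of u, so that the pulled-back density is Kφ(u) times the
  -- exponential of the increment of `logKernel` from 0.
  set K : ℝ := ε * (((m : ℝ) + 1) * m.choose y * Real.exp (logKernel m y r ε 0))
    * √(2 * Real.pi) with hKdef
  have hK : 0 < K := by
    have : (0 : ℝ) < m.choose y := by exact_mod_cast Nat.choose_pos hy
    positivity
  have hdens : ∀ v : ℝ, |v| ≤ M → betaDensity m y (cfT r ε v) * (ε * cfW' r ε v)
      = K * stdNormalPDF v * Real.exp (logKernel m y r ε v - logKernel m y r ε 0) := by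
    intro v hv
    obtain ⟨-, h1, h2, h3, -⟩ := hrange hv
    have h := betaDensity_mul_eq_exp_logKernel hy (r := r) (ε := ε) (u := v) (by linarith)
      (by linarith) (by linarith)
    have hsq : √(2 * Real.pi) ≠ 0 := by positivity
    calc betaDensity m y (cfT r ε v) * (ε * cfW' r ε v)
        = ε * (betaDensity m y (cfT r ε v) * cfW' r ε v) := by ring
      _ = _ := by
        rw [h, Real.exp_sub, hKdef, stdNormalPDF]
        field_simp
  have hρ1 : ∀ v : ℝ, |v| ≤ M → |logKernel m y r ε v - logKernel m y r ε 0| ≤ 1 := by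
    intro v hv
    refine ((hlog hv).trans ?_).trans hs'
    gcongr
  have habsM : |M| = M := abs_of_nonneg (by linarith)
  -- Here φ ≤ ε⁴ and the exponential factor is at most 3; dividing by the slope, at least εa/2,
  -- leaves (6/a)ε³.
  have hdM : ∀ v : ℝ, |v| = M → betaDensity m y (cfT r ε v) ≤ K * (6 / a * ε ^ 3) := by
    intro v hv
    obtain ⟨-, h1, h2, h3, -⟩ := hrange hv.le
    have hexp : Real.exp (logKernel m y r ε v - logKernel m y r ε 0) ≤ 3 := by
      refine (Real.exp_le_exp.2 (le_of_abs_le (hρ1 v hv.le))).trans ?_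
      linarith [Real.exp_one_lt_d9]
    have hpdf : stdNormalPDF v ≤ ε ^ 4 := by
      refine (stdNormalPDF_le_exp v).trans ?_
      rwa [← sq_abs, hv]
    have hle : betaDensity m y (cfT r ε v) * (ε * (a / 2)) ≤ K * (6 / a * ε ^ 3) * (ε * (a / 2)) := by
      calc betaDensity m y (cfT r ε v) * (ε * (a / 2))
          ≤ betaDensity m y (cfT r ε v) * (ε * cfW' r ε v) := by
            have := betaDensity_nonneg m y (t := cfT r ε v) (by linarith) (by linarith)
            gcongr
        _ = K * stdNormalPDF v * Real.exp (logKernel m y r ε v - logKernel m y r ε 0) :=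
            hdens v hv.le
        _ ≤ K * ε ^ 4 * 3 := by gcongr
        _ = _ := by field_simp; ring
    exact le_of_mul_le_mul_right hle (by positivity)
  have hcoef := mul_sub_cfT_eq hε hn hry
  have hσ := le_bsd ha ha' hr
  -- The points at levels -M and M lie on opposite sides of the mode, because |W| ≥ σM - a/4 ≥ 3a/4
  -- there, while the shift ε(1 - T) is at most a/4.
  have hleft : (m : ℝ) * cfT r ε (-M) ≤ y := by
    obtain ⟨h0, h1, h2, -⟩ := hrange (v := -M) (by rw [abs_neg, habsM])
    have h0' := (abs_le.1 h0).2
    have : 0 ≤ ε * (y - m * cfT r ε (-M)) := by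
      rw [hcoef]
      have : ε * (1 - cfT r ε (-M)) ≤ ε * 1 := by gcongr; linarith
      nlinarith
    linarith [nonneg_of_mul_nonneg_right this hε]
  have hright : (y : ℝ) ≤ m * cfT r ε M := by
    obtain ⟨h0, h1, h2, -⟩ := hrange habsM.le
    have h0' := (abs_le.1 h0).1
    have : 0 ≤ ε * (m * cfT r ε M - y) := by
      have h3 := hcoef M
      have : 0 ≤ ε * (1 - cfT r ε M) := mul_nonneg hε.le (by linarith)
      nlinarith
    linarith [nonneg_of_mul_nonneg_right this hε]
  have hmono := binomialUpperTail_strictMonoOn (m + 1) (y + 1) (by omega) (by omega)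
  have hτ : 6 / a * ε ^ 3 ≤ (6 / a + 1) * ε ^ 3 := by
    rw [add_mul]; linarith [pow_pos hε 3]
  obtain ⟨-, l1, l2, -⟩ := hrange (v := -M) (by rw [abs_neg, habsM])
  obtain ⟨-, u1, u2, -⟩ := hrange habsM.le
  -- In τ, 6/a serves the beta tails and 1 the normal tail. In δ, 16 = 2 · 8 comes from |e^w - 1| ≤
  -- 2|w| for |w| ≤ 1.
  refine abs_sub_stdNormalCDF_le (F := fun v => binomialUpperTail (m + 1) (y + 1) (cfT r ε v))
    (f := fun v => betaDensity m y (cfT r ε v) * (ε * cfW' r ε v)) (K := K) (M := M)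
    (δ := 16 * C / a ^ 3 * ε ^ 3) (C := D) (τ := (6 / a + 1) * ε ^ 3) (j := k + 1) hK
    (by positivity) hD ?_ ?_ hj ?_ ?_ ?_ ?_ ?_ (le_of_eq (by ring)) hη (abs_le.1 hu)
  · intro v _
    exact (binomialUpperTail_hasDerivAt m y hy _).comp v (hasDerivAt_cfT r ε v)
  · intro v hv
    have hv' : |v| ≤ M := abs_le.2 hv
    have hpos := mul_pos hK (stdNormalPDF_pos v)
    rw [hdens v hv']
    calc |K * stdNormalPDF v * Real.exp (logKernel m y r ε v - logKernel m y r ε 0)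
          - K * stdNormalPDF v|
        = K * stdNormalPDF v * |Real.exp (logKernel m y r ε v - logKernel m y r ε 0) - 1| := by
          rw [← abs_of_pos hpos, ← abs_mul, abs_of_pos hpos]; congr 1; ring
      _ ≤ K * stdNormalPDF v * (2 * |logKernel m y r ε v - logKernel m y r ε 0|) := by
          gcongr
          exact Real.abs_exp_sub_one_le (hρ1 v hv')
      _ ≤ K * stdNormalPDF v * (2 * (8 * C / a ^ 3 * ε ^ 3 * (1 + |v|) ^ (k + 1))) := by
          gcongr
          exact hlog hv'
      _ = _ := by ring
  · have := hmono.monotoneOn (Set.left_mem_Icc.2 zero_le_one)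
      (⟨by linarith, by linarith⟩ : cfT r ε (-M) ∈ Set.Icc (0 : ℝ) 1) (by linarith)
    rwa [binomialUpperTail_zero _ _ (by omega)] at this
  · refine (binomialUpperTail_le_betaDensity y m hy (by linarith) (by linarith) hleft).trans ?_
    exact (hdM _ (by rw [abs_neg, habsM])).trans (by gcongr)
  · have := hmono.monotoneOn (⟨by linarith, by linarith⟩ : cfT r ε M ∈ Set.Icc (0 : ℝ) 1)
      (Set.right_mem_Icc.2 zero_le_one) (by linarith)
    rwa [binomialUpperTail_one _ _ (by omega)] at this
  · refine (one_sub_binomialUpperTail_le_betaDensity y m hy (by linarith) (by linarith)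
      hright).trans ?_
    exact (hdM _ habsM).trans (by gcongr)
  · refine (stdNormalCDF_neg_le (by linarith)).trans (hMε.trans ?_)
    have h3 := pow_pos hε 3
    have : ε ^ 4 ≤ 1 * ε ^ 3 := by
      rw [pow_succ ε 3, mul_comm]; gcongr
    refine this.trans ?_
    gcongr
    have : 0 < 6 / a := by positivity
    linarith

end LocalExpansion

/-! ### Inversion: uniform expansion of the lower end point -/

lemma exists_common_bound {a : ℝ} (ha : 0 < a) : ∃ C : ℝ, ∃ k : ℕ, 1 ≤ C ∧
    ∀ r ∈ Set.Icc a (1 - a), ∀ ε ∈ Set.Icc (0 : ℝ) 1, ∀ u : ℝ,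
      |cfE r ε u| ≤ C * (1 + |u|) ^ k ∧ |cfE' r ε u| ≤ C * (1 + |u|) ^ k ∧
        |cfQ r ε u| ≤ C * (1 + |u|) ^ k := by
  obtain ⟨C₁, k₁, h₁, hE⟩ := polyGrowth_cfE ha
  obtain ⟨C₂, k₂, h₂, hE'⟩ := polyGrowth_cfE' ha
  obtain ⟨C₃, k₃, h₃, hQ⟩ := polyGrowth_cfQ ha
  refine ⟨1 + C₁ + C₂ + C₃, k₁ + k₂ + k₃, by linarith, fun r hr ε hε u => ?_⟩
  have h1 : (1 : ℝ) ≤ 1 + |u| := by linarith [abs_nonneg u]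
  refine ⟨(hE r hr ε hε u).trans ?_, (hE' r hr ε hε u).trans ?_, (hQ r hr ε hε u).trans ?_⟩ <;>
  · apply mul_le_mul (by linarith) (pow_le_pow_right₀ h1 (by omega)) (by positivity)
    linarith

lemma tendsto_inv_mul_log_pow (k : ℕ) :
    Tendsto (fun s : ℝ => s⁻¹ * (1 + 2 * Real.log s) ^ k) atTop (nhds 0) := by
  have h := (Real.tendsto_pow_log_div_mul_add_atTop 1 0 k one_ne_zero).const_mul ((3 : ℝ) ^ k)
  rw [mul_zero] at h
  refine squeeze_zero' ?_ ?_ h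
  · filter_upwards [eventually_ge_atTop 1] with s hs
    have := Real.log_nonneg hs
    positivity
  · filter_upwards [eventually_ge_atTop (Real.exp 1)] with s hs
    have hs0 : 0 < s := (Real.exp_pos 1).trans_le hs
    have h1 : 1 ≤ Real.log s := by rwa [Real.le_log_iff_exp_le hs0]
    rw [one_mul, add_zero, mul_div_assoc', ← mul_pow, div_eq_inv_mul]
    gcongr
    linarith

lemma abs_cfT_sub_le {r ε M : ℝ} (hε : 0 ≤ ε)
    (h : ∀ u, |u| ≤ M → |cfW' r ε u| ≤ 2) {u v : ℝ} (hu : |u| ≤ M) (hv : |v| ≤ M) :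
    |cfT r ε u - cfT r ε v| ≤ 2 * ε * |u - v| := by
  have := (convex_Icc (-M) M).norm_image_sub_le_of_norm_hasDerivWithin_le (f := cfT r ε)
    (f' := fun u => ε * cfW' r ε u) (C := 2 * ε)
    (fun w _ => (hasDerivAt_cfT r ε w).hasDerivWithinAt) (fun w hw => by
      rw [Real.norm_eq_abs, abs_mul, abs_of_nonneg hε, mul_comm]
      exact mul_le_mul_of_nonneg_right (h w (abs_le.2 hw)) hε) (abs_le.1 hv) (abs_le.1 hu)
  simpa [Real.norm_eq_abs] using this

lemma stdNormalPDF_ge {u B : ℝ} (h : |u| ≤ B) : stdNormalPDF B ≤ stdNormalPDF u := by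
  unfold stdNormalPDF
  have := sq_le_sq' (by linarith [neg_abs_le u] : -B ≤ u) (le_of_abs_le h)
  gcongr

lemma stdNormalCDF_sub_ge {B u v : ℝ} (hu : |u| ≤ B) (hv : |v| ≤ B) (huv : u ≤ v) :
    stdNormalPDF B * (v - u) ≤ stdNormalCDF v - stdNormalCDF u :=
  Convex.mul_sub_le_image_sub_of_le_deriv (convex_Icc (-B) B)
    stdNormalCDF_continuous.continuousOn
    (fun w _ => (hasDerivAt_stdNormalCDF w).differentiableAt.differentiableWithinAt)
    (fun w hw => by
      have hw' : w ∈ Set.Icc (-B) B := interior_subset hw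
      rw [(hasDerivAt_stdNormalCDF w).deriv]
      exact stdNormalPDF_ge (abs_le.2 hw'))
    u (abs_le.1 hu) v (abs_le.1 hv) huv

/-- Uniform Cornish–Fisher expansion of the lower Clopper–Pearson end point. -/
theorem exists_abs_clopperPearsonLower_sub_le {a α : ℝ} (ha : 0 < a) (ha' : a ≤ 1 / 2)
    (hα : α ∈ Set.Ioo (0 : ℝ) 1) : ∃ H : ℝ, 0 ≤ H ∧ ∀ᶠ n : ℕ in atTop, ∀ x : ℕ, x ≤ n →
      (x / n : ℝ) ∈ Set.Icc a (1 - a) →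
      |clopperPearsonLower n α x
        - cfT (x / n) (√n)⁻¹ (-stdNormalUpperQuantile (α / 2))| ≤ H * (√n)⁻¹ ^ 4 := by
  obtain ⟨C, k, hC, hb⟩ := exists_common_bound ha
  obtain ⟨D, hD, hj⟩ := exists_stdNormalPDF_mul_pow_le (k + 1)
  set z := stdNormalUpperQuantile (α / 2)
  have hz : stdNormalCDF (-z) = α / 2 :=
    stdNormalCDF_neg_upperQuantile (by linarith [hα.1]) (by linarith [hα.2])
  set A : ℝ := 16 * C / a ^ 3 * D * Real.pi + 2 * (6 / a + 1) with hA
  have hA0 : 0 ≤ A := by positivity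
  set c := stdNormalPDF (|z| + 1)
  have hc : 0 < c := stdNormalPDF_pos _
  -- As φ ≥ c for |u| ≤ |z| + 1, a shift of the level by η = Hε³ changes Φ by at least (6A + 1)ε³,
  -- strictly more than the error 6Aε³.
  set H := (6 * A + 1) / c with hH
  have hH0 : 0 ≤ H := by positivity
  refine ⟨2 * H, by positivity, ?_⟩
  have hinv : Tendsto (fun s : ℝ => s⁻¹) atTop (nhds 0) := tendsto_inv_atTop_zero
  have hinv3 : ∀ B : ℝ, Tendsto (fun s : ℝ => B * s⁻¹ ^ 3) atTop (nhds 0) := fun B => by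
    simpa using (hinv.pow 3).const_mul B
  have hlogC := (tendsto_inv_mul_log_pow (k + 1)).const_mul C
  have hlog3 := ((tendsto_inv_mul_log_pow (k + 1)).mul (hinv.pow 2)).const_mul (8 * C / a ^ 3)
  rw [mul_zero] at hlogC
  rw [zero_mul, mul_zero] at hlog3
  -- All conditions involve s = √n alone, so the threshold does not depend on x.
  have ev : ∀ᶠ s : ℝ in atTop, 0 < s ∧ s⁻¹ ≤ a / 4 ∧ A * s⁻¹ ^ 3 ≤ 1 / 4 ∧ H * s⁻¹ ^ 3 ≤ 1 ∧
      C * (s⁻¹ * (1 + 2 * Real.log s) ^ (k + 1)) ≤ a / 4 ∧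
      8 * C / a ^ 3 * (s⁻¹ * (1 + 2 * Real.log s) ^ (k + 1) * s⁻¹ ^ 2) ≤ 1 ∧
      2 ≤ Real.log s ∧ |z| + 1 ≤ Real.log s := by
    filter_upwards [eventually_gt_atTop 0, hinv.eventually_le_const (by positivity : 0 < a / 4),
      (hinv3 A).eventually_le_const (by norm_num : (0 : ℝ) < 1 / 4),
      (hinv3 H).eventually_le_const zero_lt_one,
      hlogC.eventually_le_const (by positivity : 0 < a / 4),
      hlog3.eventually_le_const zero_lt_one, Real.tendsto_log_atTop.eventually_ge_atTop 2,
      Real.tendsto_log_atTop.eventually_ge_atTop (|z| + 1)] with s h1 h2 h3 h4 h5 h6 h7 h8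
    exact ⟨h1, h2, h3, h4, h5, h6, h7, h8⟩
  have hsq : Tendsto (fun n : ℕ => √(n : ℝ)) atTop atTop :=
    Real.tendsto_sqrt_atTop.comp tendsto_natCast_atTop_atTop
  filter_upwards [hsq.eventually ev] with n hn x hxn hr
  obtain ⟨hs0, hεa, hA4, hH1, hlog, hlog', h2, hz1⟩ := hn
  have hn0 : 0 < n := Nat.pos_of_ne_zero fun h => by simp [h] at hs0
  have hn0' : (0 : ℝ) < n := by exact_mod_cast hn0
  have hx0 : x ≠ 0 := fun h => by
    rw [h, Nat.cast_zero, zero_div] at hr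
    linarith [hr.1]
  obtain ⟨m, rfl⟩ : ∃ m, n = m + 1 := ⟨n - 1, by omega⟩
  obtain ⟨y, rfl⟩ : ∃ y, x = y + 1 := ⟨x - 1, by omega⟩
  set s := √((m + 1 : ℕ) : ℝ) with hs
  set ε := s⁻¹ with hεdef
  set r : ℝ := ((y + 1 : ℕ) : ℝ) / ((m + 1 : ℕ) : ℝ) with hrdef
  have hε : 0 < ε := inv_pos.2 hs0
  have hε1 : ε ≤ 1 := by linarith
  -- M = log n: exp(-M²/2) ≤ ε⁴ as soon as log s ≥ 2, while ε times any fixed power of 1 + M tends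
  -- to 0.
  set M := 2 * Real.log s with hMdef
  have hs2 : s ^ 2 = m + 1 := by rw [hs, Real.sq_sqrt hn0'.le]; push_cast; rfl
  have hn1 : ε ^ 2 * ((m : ℝ) + 1) = 1 := by
    rw [← hs2, hεdef, ← mul_pow, inv_mul_cancel₀ hs0.ne', one_pow]
  have hry : r * ((m : ℝ) + 1) = y + 1 := by
    rw [hrdef]; push_cast; field_simp
  have hMε : Real.exp (-(M ^ 2 / 2)) ≤ ε ^ 4 := by
    have : ε ^ 4 = Real.exp (-(4 * Real.log s)) := by
      rw [Real.exp_neg, hεdef, inv_pow, ← Real.exp_log hs0, ← Real.exp_nat_mul, Real.log_exp]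
      norm_num
    rw [this, Real.exp_le_exp, hMdef]
    nlinarith
  have hbE := fun u => (hb r hr ε ⟨hε.le, hε1⟩ u).1
  have hbE' := fun u => (hb r hr ε ⟨hε.le, hε1⟩ u).2.1
  have hbQ := fun u => (hb r hr ε ⟨hε.le, hε1⟩ u).2.2
  have hsm : ε * (C * (1 + M) ^ (k + 1)) ≤ a / 4 := by
    rw [mul_left_comm]; exact hlog
  have hsm' : 8 * C / a ^ 3 * ε ^ 3 * (1 + M) ^ (k + 1) ≤ 1 := by
    refine le_of_eq_of_le ?_ hlog'; ring
  have main := fun {u : ℝ} (hu : |u| ≤ M) =>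
    abs_binomialUpperTail_cfT_sub_le (y := y) ha ha' hC hε hεa (by omega) hn1 hr hry hbE hbE' hbQ
      (by linarith) hMε hsm hsm' hD hj hA4 hu
  have range := fun {u : ℝ} (hu : |u| ≤ M) => cf_range ha ha' hC hε hε1 hr hbE hbE' hsm hu
  obtain ⟨hp, hpe⟩ := clopperPearsonLower_spec (m + 1) (y + 1) (by omega) hxn α hα
  set P := clopperPearsonLower (m + 1) α (y + 1)
  have hmono := binomialUpperTail_strictMonoOn (m + 1) (y + 1) (by omega) hxn
  set η := H * ε ^ 3 with hη
  have hη0 : 0 ≤ η := by positivity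
  have hη1 : η ≤ 1 := hH1
  have hcη : c * η = (6 * A + 1) * ε ^ 3 := by
    rw [hη, hH]; field_simp
  have hz0 : |-z| ≤ |z| + 1 := by rw [abs_neg]; linarith
  have hup : |-z + η| ≤ |z| + 1 := by
    refine (abs_add_le _ _).trans ?_
    rw [abs_neg, abs_of_nonneg hη0]; linarith
  have hlo : |-z - η| ≤ |z| + 1 := by
    refine (abs_sub _ _).trans ?_
    rw [abs_neg, abs_of_nonneg hη0]; linarith
  have hzM : |z| + 1 ≤ M := by linarith
  have hε3 := pow_pos hε 3
  have hW2 : ∀ u, |u| ≤ M → |cfW' r ε u| ≤ 2 := fun u hu => by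
    obtain ⟨-, -, -, h1, h2⟩ := range hu
    rw [abs_of_nonneg (by linarith)]; exact h2
  -- Monotonicity of the tail brackets P between the values of `cfT` at -z ± η; its slope, at most
  -- 2ε, turns η into the final error 2Hε⁴.
  have hP1 : P < cfT r ε (-z + η) := by
    obtain ⟨-, h1, h2, -⟩ := range (hup.trans hzM)
    have h3 := (abs_le.1 (main (hup.trans hzM))).1
    have h4 := stdNormalCDF_sub_ge hz0 hup (by linarith)
    rw [add_sub_cancel_left, hcη, hz] at h4
    refine (hmono.lt_iff_lt hp ⟨by linarith, by linarith⟩).1 ?_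
    rw [hpe]
    linarith
  have hP2 : cfT r ε (-z - η) < P := by
    obtain ⟨-, h1, h2, -⟩ := range (hlo.trans hzM)
    have h3 := (abs_le.1 (main (hlo.trans hzM))).2
    have h4 := stdNormalCDF_sub_ge hlo hz0 (by linarith)
    rw [sub_sub_cancel, hcη, hz] at h4
    refine (hmono.lt_iff_lt ⟨by linarith, by linarith⟩ hp).1 ?_
    rw [hpe]
    linarith
  have d1 := abs_cfT_sub_le hε.le hW2 (hup.trans hzM) (hz0.trans hzM)
  have d2 := abs_cfT_sub_le hε.le hW2 (hlo.trans hzM) (hz0.trans hzM)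
  rw [add_sub_cancel_left, abs_of_nonneg hη0] at d1
  rw [sub_sub_cancel_left, abs_neg, abs_of_nonneg hη0] at d2
  have e : 2 * H * ε ^ 4 = 2 * ε * η := by rw [hη]; ring
  rw [e, abs_le]
  constructor
  · linarith [(abs_le.1 d2).1]
  · linarith [(abs_le.1 d1).2]

/-! ### Central moments of the binomial distribution -/

/-- The expectation of `f X` for `X ~ Bin(n, p)`, as a finite sum. -/
noncomputable def binomialMean (n : ℕ) (p : ℝ) (f : ℕ → ℝ) : ℝ :=
  ∑ k ∈ Finset.range (n + 1), (n.choose k : ℝ) * p ^ k * (1 - p) ^ (n - k) * f k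

/-- Pascal's rule, that is, conditioning on one trial. -/
lemma binomialMean_succ (n : ℕ) (p : ℝ) (f : ℕ → ℝ) :
    binomialMean (n + 1) p f
      = (1 - p) * binomialMean n p f + p * binomialMean n p (fun k => f (k + 1)) := by
  have h1 : binomialMean n p f = (1 - p) ^ n * f 0
      + ∑ k ∈ Finset.range (n + 1),
        (n.choose (k + 1) : ℝ) * p ^ (k + 1) * (1 - p) ^ (n - (k + 1)) * f (k + 1) := by
    rw [Finset.sum_range_succ, Nat.choose_eq_zero_of_lt (Nat.lt_succ_self n), binomialMean,
      Finset.sum_range_succ']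
    simp
    ring
  rw [h1, binomialMean, Finset.sum_range_succ', binomialMean, mul_add, Finset.mul_sum,
    Finset.mul_sum]
  have h2 : ∀ k ∈ Finset.range (n + 1),
      ((n + 1).choose (k + 1) : ℝ) * p ^ (k + 1) * (1 - p) ^ (n + 1 - (k + 1)) * f (k + 1)
      = (1 - p) * ((n.choose (k + 1) : ℝ) * p ^ (k + 1) * (1 - p) ^ (n - (k + 1)) * f (k + 1))
        + p * ((n.choose k : ℝ) * p ^ k * (1 - p) ^ (n - k) * f (k + 1)) := by
    intro k hk
    rw [Nat.choose_succ_succ, Nat.add_sub_add_right]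
    rcases Nat.lt_or_ge k n with h | h
    · rw [show n - k = (n - (k + 1)) + 1 by omega]
      push_cast
      ring
    · rw [Nat.choose_eq_zero_of_lt (by omega : n < k + 1)]
      push_cast
      ring
  rw [Finset.sum_congr rfl h2, Finset.sum_add_distrib]
  simp
  ring

lemma binomialMean_add (n : ℕ) (p : ℝ) (f g : ℕ → ℝ) :
    binomialMean n p (fun k => f k + g k) = binomialMean n p f + binomialMean n p g := by
  simp only [binomialMean, mul_add, Finset.sum_add_distrib]

lemma binomialMean_sub (n : ℕ) (p : ℝ) (f g : ℕ → ℝ) :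
    binomialMean n p (fun k => f k - g k) = binomialMean n p f - binomialMean n p g := by
  simp only [binomialMean, mul_sub, Finset.sum_sub_distrib]

lemma binomialMean_const_mul (n : ℕ) (p c : ℝ) (f : ℕ → ℝ) :
    binomialMean n p (fun k => c * f k) = c * binomialMean n p f := by
  simp only [binomialMean, Finset.mul_sum]
  exact Finset.sum_congr rfl fun _ _ => by ring

lemma abs_binomialMean_le {n : ℕ} {p : ℝ} (hp0 : 0 ≤ p) (hp1 : p ≤ 1) {f g : ℕ → ℝ}
    (h : ∀ k ≤ n, |f k| ≤ g k) : |binomialMean n p f| ≤ binomialMean n p g := by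
  refine (Finset.abs_sum_le_sum_abs _ _).trans (Finset.sum_le_sum fun k hk => ?_)
  have hw : 0 ≤ (n.choose k : ℝ) * p ^ k * (1 - p) ^ (n - k) := by
    have : 0 ≤ 1 - p := by linarith
    positivity
  rw [abs_mul, abs_of_nonneg hw]
  exact mul_le_mul_of_nonneg_left (h k (by simpa [Nat.lt_succ_iff] using hk)) hw

/-- Central moments of the binomial distribution. -/
noncomputable def binomialCentralMoment (n : ℕ) (p : ℝ) (j : ℕ) : ℝ :=
  binomialMean n p (fun k => ((k : ℝ) - n * p) ^ j)

lemma binomialMean_poly (n : ℕ) (p c₀ c₁ c₂ c₃ c₄ : ℝ) :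
    binomialMean n p (fun k => c₀ * ((k : ℝ) - n * p) ^ 0 + c₁ * ((k : ℝ) - n * p) ^ 1
      + c₂ * ((k : ℝ) - n * p) ^ 2 + c₃ * ((k : ℝ) - n * p) ^ 3 + c₄ * ((k : ℝ) - n * p) ^ 4)
    = c₀ * binomialCentralMoment n p 0 + c₁ * binomialCentralMoment n p 1
      + c₂ * binomialCentralMoment n p 2 + c₃ * binomialCentralMoment n p 3
      + c₄ * binomialCentralMoment n p 4 := by
  simp only [binomialMean_add, binomialMean_const_mul, binomialCentralMoment]

/-- One more trial shifts the centred variable by -p or by 1 - p. Expanding the power gives each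
moment by induction on n from the lower ones. -/
lemma binomialCentralMoment_succ (n : ℕ) (p : ℝ) (j : ℕ) :
    binomialCentralMoment (n + 1) p j
      = (1 - p) * binomialMean n p (fun k => (((k : ℝ) - n * p) - p) ^ j)
        + p * binomialMean n p (fun k => (((k : ℝ) - n * p) + (1 - p)) ^ j) := by
  rw [binomialCentralMoment, binomialMean_succ]
  push_cast
  congr 3 <;> funext k <;> ring_nf

lemma binomialCentralMoment_zero_left (p : ℝ) (j : ℕ) :
    binomialCentralMoment 0 p j = 0 ^ j := by
  simp [binomialCentralMoment, binomialMean]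

lemma binomialCentralMoment_zero (n : ℕ) (p : ℝ) : binomialCentralMoment n p 0 = 1 := by
  induction n with
  | zero => simp [binomialCentralMoment_zero_left]
  | succ n ih =>
    rw [binomialCentralMoment_succ]
    simp only [pow_zero]
    simp only [binomialCentralMoment, pow_zero] at ih
    rw [ih]; ring

lemma binomialCentralMoment_one (n : ℕ) (p : ℝ) : binomialCentralMoment n p 1 = 0 := by
  induction n with
  | zero => simp [binomialCentralMoment_zero_left]
  | succ n ih =>
    have h := fun c => binomialMean_poly n p c 1 0 0 0
    simp only [ih, binomialCentralMoment_zero] at h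
    rw [binomialCentralMoment_succ]
    have e1 := h (-p)
    have e2 := h (1 - p)
    ring_nf at e1 e2 ⊢
    rw [e1, e2]; ring

lemma binomialCentralMoment_two (n : ℕ) (p : ℝ) :
    binomialCentralMoment n p 2 = n * (p * (1 - p)) := by
  induction n with
  | zero => simp [binomialCentralMoment_zero_left]
  | succ n ih =>
    have h : ∀ c, binomialMean n p (fun k => (((k : ℝ) - n * p) + c) ^ 2)
        = c ^ 2 + n * (p * (1 - p)) := by
      intro c
      have := binomialMean_poly n p (c ^ 2) (2 * c) 1 0 0
      rw [ih, binomialCentralMoment_zero, binomialCentralMoment_one] at this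
      refine Eq.trans ?_ (this.trans (by ring))
      congr 1; funext k; ring
    have h' := h (-p)
    simp only [← sub_eq_add_neg] at h'
    rw [binomialCentralMoment_succ, h, h']
    push_cast
    ring

lemma binomialCentralMoment_three (n : ℕ) (p : ℝ) :
    binomialCentralMoment n p 3 = n * (p * (1 - p) * (1 - 2 * p)) := by
  induction n with
  | zero => simp [binomialCentralMoment_zero_left]
  | succ n ih =>
    have h : ∀ c, binomialMean n p (fun k => (((k : ℝ) - n * p) + c) ^ 3)
        = c ^ 3 + 3 * c * (n * (p * (1 - p))) + n * (p * (1 - p) * (1 - 2 * p)) := by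
      intro c
      have := binomialMean_poly n p (c ^ 3) (3 * c ^ 2) (3 * c) 1 0
      rw [ih, binomialCentralMoment_zero, binomialCentralMoment_one,
        binomialCentralMoment_two] at this
      refine Eq.trans ?_ (this.trans (by ring))
      congr 1; funext k; ring
    have h' := h (-p)
    simp only [← sub_eq_add_neg] at h'
    rw [binomialCentralMoment_succ, h, h']
    push_cast
    ring

lemma binomialCentralMoment_four (n : ℕ) (p : ℝ) :
    binomialCentralMoment n p 4
      = 3 * n ^ 2 * (p * (1 - p)) ^ 2 + n * (p * (1 - p) * (1 - 6 * (p * (1 - p)))) := by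
  induction n with
  | zero => simp [binomialCentralMoment_zero_left]
  | succ n ih =>
    have h : ∀ c, binomialMean n p (fun k => (((k : ℝ) - n * p) + c) ^ 4)
        = c ^ 4 + 6 * c ^ 2 * (n * (p * (1 - p))) + 4 * c * (n * (p * (1 - p) * (1 - 2 * p)))
          + (3 * n ^ 2 * (p * (1 - p)) ^ 2 + n * (p * (1 - p) * (1 - 6 * (p * (1 - p))))) := by
      intro c
      have := binomialMean_poly n p (c ^ 4) (4 * c ^ 3) (6 * c ^ 2) (4 * c) 1
      rw [ih, binomialCentralMoment_zero, binomialCentralMoment_one,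
        binomialCentralMoment_two, binomialCentralMoment_three] at this
      refine Eq.trans ?_ (this.trans (by ring))
      congr 1; funext k; ring
    have h' := h (-p)
    simp only [← sub_eq_add_neg] at h'
    rw [binomialCentralMoment_succ, h, h']
    push_cast
    ring

/-- The mean of a polynomial of degree at most four in the deviation of the sample proportion. -/
lemma binomialMean_poly_proportion {n : ℕ} (hn : n ≠ 0) (p c₀ c₁ c₂ c₃ c₄ : ℝ) :
    binomialMean n p (fun k => c₀ + c₁ * ((k : ℝ) / n - p) + c₂ * ((k : ℝ) / n - p) ^ 2
      + c₃ * ((k : ℝ) / n - p) ^ 3 + c₄ * ((k : ℝ) / n - p) ^ 4)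
    = c₀ + c₂ * (p * (1 - p)) * (n : ℝ)⁻¹
      + c₃ * (p * (1 - p) * (1 - 2 * p)) * (n : ℝ)⁻¹ ^ 2
      + c₄ * (3 * (p * (1 - p)) ^ 2 * (n : ℝ)⁻¹ ^ 2
        + p * (1 - p) * (1 - 6 * (p * (1 - p))) * (n : ℝ)⁻¹ ^ 3) := by
  have hn' : (n : ℝ) ≠ 0 := Nat.cast_ne_zero.2 hn
  have h := binomialMean_poly n p c₀ (c₁ * (n : ℝ)⁻¹) (c₂ * (n : ℝ)⁻¹ ^ 2) (c₃ * (n : ℝ)⁻¹ ^ 3)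
    (c₄ * (n : ℝ)⁻¹ ^ 4)
  rw [binomialCentralMoment_zero, binomialCentralMoment_one, binomialCentralMoment_two,
    binomialCentralMoment_three, binomialCentralMoment_four] at h
  refine Eq.trans ?_ (h.trans ?_)
  · congr 1; funext k
    have : (k : ℝ) / n - p = (n : ℝ)⁻¹ * (k - n * p) := by field_simp
    rw [this]; ring
  · field_simp; ring

/-! ### Reflection and the length at a fixed sample proportion -/

lemma expectedClopperPearsonLength_eq (n : ℕ) (α : ℝ) (p : unitInterval) :
    expectedClopperPearsonLength n α p = binomialMean n p (clopperPearsonLength n α) := by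
  rw [expectedClopperPearsonLength, integral_binomial, binomialMean]
  refine Finset.sum_congr ?_ fun k _ => rfl
  ext k; simp

lemma binomialLowerTail_one_sub {n x : ℕ} (hx : x ≤ n) (θ : ℝ) :
    binomialLowerTail n x (1 - θ) = binomialUpperTail n (n - x) θ := by
  rw [binomialLowerTail, binomialUpperTail]
  refine Finset.sum_bij (fun k _ => n - k) ?_ ?_ ?_ ?_
  · intro k hk
    rw [Finset.mem_range] at hk
    rw [Finset.mem_Icc]; omega
  · intro k hk l hl h
    rw [Finset.mem_range] at hk hl
    omega
  · intro k hk
    rw [Finset.mem_Icc] at hk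
    exact ⟨n - k, by rw [Finset.mem_range]; omega, by omega⟩
  · intro k hk
    rw [Finset.mem_range] at hk
    rw [Nat.choose_symm (by omega : k ≤ n), show n - (n - k) = k by omega]
    ring

/-- Exchanging successes and failures swaps the two tail equations, and uniqueness of the root
identifies the end points. At x = n the default values 1 and 0 match. -/
lemma clopperPearsonUpper_eq_one_sub {n x : ℕ} (hx : x ≤ n) {α : ℝ}
    (hα : α ∈ Set.Ioo (0 : ℝ) 1) :
    clopperPearsonUpper n α x = 1 - clopperPearsonLower n α (n - x) := by
  rcases hx.eq_or_lt with rfl | h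
  · simp [clopperPearsonUpper, clopperPearsonLower]
  · obtain ⟨h1, h2⟩ := clopperPearsonUpper_spec n x h α hα
    obtain ⟨h3, h4⟩ := clopperPearsonLower_spec n (n - x) (by omega) (by omega) α hα
    obtain ⟨θ, -, hu⟩ := existsUnique_binomialLowerTail_eq n x h (α / 2)
      ⟨by linarith [hα.1], by linarith [hα.2]⟩
    rw [hu _ ⟨h1, h2⟩]
    refine (hu _ ⟨⟨by linarith [h3.2], by linarith [h3.1]⟩, ?_⟩).symm
    rw [binomialLowerTail_one_sub hx, h4]

lemma clopperPearsonLower_mem {n x : ℕ} (hx : x ≤ n) {α : ℝ} (hα : α ∈ Set.Ioo (0 : ℝ) 1) :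
    clopperPearsonLower n α x ∈ Set.Icc (0 : ℝ) 1 := by
  rcases eq_or_ne x 0 with rfl | h
  · simp [clopperPearsonLower]
  · exact (clopperPearsonLower_spec n x h hx α hα).1

lemma abs_clopperPearsonLength_le {n x : ℕ} (hx : x ≤ n) {α : ℝ} (hα : α ∈ Set.Ioo (0 : ℝ) 1) :
    |clopperPearsonLength n α x| ≤ 1 := by
  obtain ⟨h1, h2⟩ := clopperPearsonLower_mem hx hα
  obtain ⟨h3, h4⟩ := clopperPearsonLower_mem (Nat.sub_le n x) hα
  rw [clopperPearsonLength, clopperPearsonUpper_eq_one_sub hx hα, abs_le]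
  constructor <;> linarith

/-- Coefficient of `n ^ (-3/2)` in the expansion of the length at sample proportion `r`. -/
noncomputable def lengthCoeff (z r : ℝ) : ℝ :=
  z / 18 * ((1 - 13 * (r * (1 - r))) * z ^ 2 + 2 - 17 * (r * (1 - r))) * (bsd r)⁻¹

lemma bsd_one_sub (r : ℝ) : bsd (1 - r) = bsd r := by
  unfold bsd; congr 1; ring

/-- Under r ↦ 1 - r the coefficient `cfA` is odd, so the ε²z² terms cancel, while the two values of
`cfB` add up to -1, which is the source of the term 1/n. -/
lemma one_sub_cfT_sub_cfT {r : ℝ} (h0 : 0 < r) (h1 : r < 1) (ε z : ℝ) :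
    1 - cfT (1 - r) ε (-z) - cfT r ε (-z)
      = 2 * z * ε * bsd r + ε ^ 2 + ε ^ 3 * lengthCoeff z r := by
  have hv : 0 < r * (1 - r) := mul_pos h0 (by linarith)
  have hσ : 0 < bsd r := Real.sqrt_pos.2 hv
  have hsq := bsd_sq h0 h1
  have hc : bsd r * (cfC r + cfC (1 - r)) = (1 - 13 * (r * (1 - r))) / 18 * (bsd r)⁻¹ := by
    have : cfC (1 - r) = cfC r := by
      unfold cfC; rw [sub_sub_cancel, mul_comm r]
    rw [this, cfC, ← hsq]
    field_simp
    ring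
  have hd : bsd r * (cfD r + cfD (1 - r)) = (2 - 17 * (r * (1 - r))) / 18 * (bsd r)⁻¹ := by
    have : cfD r + cfD (1 - r) = (2 - 17 * (r * (1 - r))) / 18 / (r * (1 - r)) := by
      unfold cfD cfA cfB
      rw [sub_sub_cancel, mul_comm (1 - r) r, ← add_div]
      congr 1
      ring
    rw [this, ← hsq]
    field_simp
  simp only [cfT, cfW, cfE, bsd_one_sub, lengthCoeff]
  have ha : cfA (1 - r) = -cfA r := by unfold cfA; ring
  have hb : cfB (1 - r) = -1 - cfB r := by unfold cfB; ring
  rw [ha, hb]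
  linear_combination ε ^ 3 * z ^ 3 * hc + ε ^ 3 * z * hd

/-! ### Expansion in the sample proportion about p -/

/-- Third-order Taylor expansion of the binomial standard deviation. -/
lemma exists_abs_bsd_add_sub_le {p : ℝ} (hp0 : 0 < p) (hp1 : p < 1) {a : ℝ} (ha : 0 < a) :
    ∃ b₁ b₃ C δ : ℝ, 0 ≤ C ∧ 0 < δ ∧ δ ≤ a ∧ ∀ d : ℝ, |d| ≤ δ → 0 ≤ p + d → p + d ≤ 1 →
      |bsd (p + d) - (bsd p + b₁ * d - 1 / (8 * bsd p ^ 3) * d ^ 2 + b₃ * d ^ 3)| ≤ C * d ^ 4 := by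
  have hv : 0 < p * (1 - p) := mul_pos hp0 (by linarith)
  have hσ : 0 < bsd p := Real.sqrt_pos.2 hv
  have hsq := bsd_sq hp0 hp1
  set σ := bsd p
  -- The coefficients make the square of the cubic P agree with (p + d)(1 - p - d) through order d³.
  -- Only the quadratic one is explicit in the statement: d has mean 0 and d³ has mean O(n⁻²).
  obtain ⟨b₁, hb₁⟩ : ∃ b, b = (1 - 2 * p) / (2 * σ) := ⟨_, rfl⟩
  obtain ⟨b₂, hb₂⟩ : ∃ b, b = -(1 / (8 * σ ^ 3)) := ⟨_, rfl⟩
  obtain ⟨b₃, hb₃⟩ : ∃ b, b = -b₁ * b₂ / σ := ⟨_, rfl⟩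
  have e1 : 2 * σ * b₁ = 1 - 2 * p := by rw [hb₁]; field_simp
  have e2 : 2 * σ * b₂ + b₁ ^ 2 = -1 := by
    rw [hb₁, hb₂]
    have : (1 - 2 * p) ^ 2 = 1 - 4 * σ ^ 2 := by rw [hsq]; ring
    field_simp
    rw [this]; ring
  have e3 : σ * b₃ + b₁ * b₂ = 0 := by rw [hb₃]; field_simp; ring
  set S := |b₁| + |b₂| + |b₃| + 1 with hS
  have hS0 : 0 < S := by positivity
  set B := |b₂ ^ 2 + 2 * b₁ * b₃| + |2 * b₂ * b₃| + b₃ ^ 2 with hB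
  -- For |d| ≤ σ/(2S) the cubic is at least σ/2, so the difference of squares can be divided by the
  -- sum, at the cost 2/σ.
  refine ⟨b₁, b₃, B * (2 / σ), min (min a 1) (σ / (2 * S)), by positivity, by positivity,
    (min_le_left _ _).trans (min_le_left _ _), fun d hd h0 h1 => ?_⟩
  have hd1 : |d| ≤ 1 := hd.trans ((min_le_left _ _).trans (min_le_right _ _))
  have hdS : |d| * S ≤ σ / 2 := by
    have := hd.trans (min_le_right _ _)
    rw [le_div_iff₀ (by positivity)] at this
    linarith
  have hd0 := abs_nonneg d
  set P := σ + b₁ * d - 1 / (8 * σ ^ 3) * d ^ 2 + b₃ * d ^ 3 with hP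
  have hP' : P = σ + (b₁ * d + b₂ * d ^ 2 + b₃ * d ^ 3) := by rw [hP, hb₂]; ring
  have hd2 : |d| ^ 2 ≤ |d| := pow_le_of_le_one hd0 hd1 (by norm_num)
  have hd3 : |d| ^ 3 ≤ |d| := pow_le_of_le_one hd0 hd1 (by norm_num)
  have hsmall : |b₁ * d + b₂ * d ^ 2 + b₃ * d ^ 3| ≤ |d| * S := by
    calc |b₁ * d + b₂ * d ^ 2 + b₃ * d ^ 3| ≤ |b₁ * d| + |b₂ * d ^ 2| + |b₃ * d ^ 3| :=
          abs_add_three _ _ _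
      _ = |b₁| * |d| + |b₂| * |d| ^ 2 + |b₃| * |d| ^ 3 := by simp only [abs_mul, abs_pow]
      _ ≤ |b₁| * |d| + |b₂| * |d| + |b₃| * |d| := by gcongr
      _ ≤ |d| * S := by rw [hS]; linarith
  have hPpos : σ / 2 ≤ P := by
    rw [hP']; linarith [neg_abs_le (b₁ * d + b₂ * d ^ 2 + b₃ * d ^ 3)]
  have hs0 := bsd_nonneg (p + d)
  have hs2 : bsd (p + d) ^ 2 = (p + d) * (1 - (p + d)) :=
    Real.sq_sqrt (mul_nonneg h0 (by linarith))
  have hdiff : (bsd (p + d) - P) * (bsd (p + d) + P)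
      = -d ^ 4 * ((b₂ ^ 2 + 2 * b₁ * b₃) + 2 * b₂ * b₃ * d + b₃ ^ 2 * d ^ 2) := by
    have : (bsd (p + d) - P) * (bsd (p + d) + P) = bsd (p + d) ^ 2 - P ^ 2 := by ring
    rw [this, hs2, hP']
    linear_combination (-1 : ℝ) * hsq - d * e1 - d ^ 2 * e2 - 2 * d ^ 3 * e3
  have hB' : |(b₂ ^ 2 + 2 * b₁ * b₃) + 2 * b₂ * b₃ * d + b₃ ^ 2 * d ^ 2| ≤ B := by
    calc _ ≤ |b₂ ^ 2 + 2 * b₁ * b₃| + |2 * b₂ * b₃ * d| + |b₃ ^ 2 * d ^ 2| := abs_add_three _ _ _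
      _ = |b₂ ^ 2 + 2 * b₁ * b₃| + |2 * b₂ * b₃| * |d| + b₃ ^ 2 * |d| ^ 2 := by
          rw [abs_mul (2 * b₂ * b₃), abs_mul (b₃ ^ 2), abs_of_nonneg (sq_nonneg b₃), abs_pow]
      _ ≤ |b₂ ^ 2 + 2 * b₁ * b₃| + |2 * b₂ * b₃| * 1 + b₃ ^ 2 * 1 := by
          gcongr; exact hd2.trans hd1
      _ = B := by rw [hB]; ring
  have habs : |bsd (p + d) - P| * (bsd (p + d) + P) ≤ d ^ 4 * B := by
    rw [← abs_of_nonneg (by linarith : 0 ≤ bsd (p + d) + P), ← abs_mul, hdiff, abs_mul, abs_neg,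
      abs_of_nonneg (by positivity : 0 ≤ d ^ 4)]
    gcongr
  have h2 : |bsd (p + d) - P| * (σ / 2) ≤ d ^ 4 * B :=
    le_trans (by gcongr; linarith) habs
  rw [← le_div_iff₀ (by positivity)] at h2
  refine h2.trans (le_of_eq ?_)
  field_simp

/-- First order is enough here: the coefficient is multiplied by ε³, and ε³|d| ≤ (ε⁴ + ε²d²)/2. -/
lemma exists_abs_lengthCoeff_sub_le (z : ℝ) {a : ℝ} (ha : 0 < a) (ha' : a ≤ 1 / 2) :
    ∃ C : ℝ, 0 ≤ C ∧ ∀ p ∈ Set.Icc a (1 - a), ∀ r ∈ Set.Icc a (1 - a),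
      |lengthCoeff z r - lengthCoeff z p| ≤ C * |r - p| := by
  refine ⟨|z| / 18 * ((13 * z ^ 2 + 17) / a + (14 * z ^ 2 + 19) * (1 / a ^ 3)), by positivity,
    fun p hp r hr => ?_⟩
  have hσp := le_bsd ha ha' hp
  have hσr := le_bsd ha ha' hr
  have hp2 := bsd_sq (ha.trans_le hp.1) (by linarith [hp.2] : p < 1)
  have hr2 := bsd_sq (ha.trans_le hr.1) (by linarith [hr.2] : r < 1)
  have hvp1 : bsd p ≤ 1 := bsd_le_one p
  have hv : |bsd r ^ 2 - bsd p ^ 2| ≤ |r - p| := by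
    rw [hp2, hr2, show r * (1 - r) - p * (1 - p) = (1 - p - r) * (r - p) by ring, abs_mul]
    refine mul_le_of_le_one_left (abs_nonneg _) ?_
    rw [abs_le]; constructor <;> linarith [hp.1, hp.2, hr.1, hr.2]
  have hs : |bsd r - bsd p| ≤ |r - p| / a := by
    rw [le_div_iff₀ ha]
    refine le_trans ?_ hv
    rw [show bsd r ^ 2 - bsd p ^ 2 = (bsd r - bsd p) * (bsd r + bsd p) by ring, abs_mul,
      abs_of_nonneg (by linarith : 0 ≤ bsd r + bsd p)]
    gcongr
    linarith
  have hi : |(bsd r)⁻¹ - (bsd p)⁻¹| ≤ |r - p| * (1 / a ^ 3) := by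
    have hr0 : bsd r ≠ 0 := by linarith
    have hp0 : bsd p ≠ 0 := by linarith
    rw [inv_sub_inv hr0 hp0, abs_div, abs_mul, abs_of_nonneg (bsd_nonneg r),
      abs_of_nonneg (bsd_nonneg p), abs_sub_comm]
    calc |bsd r - bsd p| / (bsd r * bsd p) ≤ (|r - p| / a) / (a * a) := by
          have := bsd_nonneg r
          gcongr
      _ = _ := by field_simp
  have hN : ∀ t : ℝ, 0 ≤ t → t ≤ 1 → |(1 - 13 * t) * z ^ 2 + 2 - 17 * t| ≤ 14 * z ^ 2 + 19 := by
    intro t h0 h1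
    have := sq_nonneg z
    rw [abs_le]; constructor <;> nlinarith
  have hp2' : bsd p ^ 2 ≤ 1 := pow_le_one₀ (bsd_nonneg p) hvp1
  simp only [lengthCoeff, ← hp2, ← hr2]
  have key : z / 18 * ((1 - 13 * bsd r ^ 2) * z ^ 2 + 2 - 17 * bsd r ^ 2) * (bsd r)⁻¹
      - z / 18 * ((1 - 13 * bsd p ^ 2) * z ^ 2 + 2 - 17 * bsd p ^ 2) * (bsd p)⁻¹
      = z / 18 * (-(13 * z ^ 2 + 17) * (bsd r ^ 2 - bsd p ^ 2) * (bsd r)⁻¹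
        + ((1 - 13 * bsd p ^ 2) * z ^ 2 + 2 - 17 * bsd p ^ 2) * ((bsd r)⁻¹ - (bsd p)⁻¹)) := by
    ring
  rw [key, abs_mul, abs_div, abs_of_pos (by norm_num : (0 : ℝ) < 18)]
  have t1 : |-(13 * z ^ 2 + 17) * (bsd r ^ 2 - bsd p ^ 2) * (bsd r)⁻¹|
      ≤ (13 * z ^ 2 + 17) * |r - p| * a⁻¹ := by
    rw [abs_mul, abs_mul, abs_neg, abs_of_nonneg (by positivity : 0 ≤ 13 * z ^ 2 + 17),
      abs_of_nonneg (inv_nonneg.2 (bsd_nonneg r))]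
    have := inv_nonneg.2 (bsd_nonneg r)
    gcongr
  have t2 : |((1 - 13 * bsd p ^ 2) * z ^ 2 + 2 - 17 * bsd p ^ 2) * ((bsd r)⁻¹ - (bsd p)⁻¹)|
      ≤ (14 * z ^ 2 + 19) * (|r - p| * (1 / a ^ 3)) := by
    rw [abs_mul]
    gcongr
    exact hN _ (sq_nonneg _) hp2'
  calc _ ≤ |z| / 18 * ((13 * z ^ 2 + 17) * |r - p| * a⁻¹
        + (14 * z ^ 2 + 19) * (|r - p| * (1 / a ^ 3))) := by
        gcongr
        exact (abs_add_le _ _).trans (add_le_add t1 t2)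
    _ = _ := by ring

/-- Crude bound for sample proportions far from p, where the expansion is not accurate. -/
lemma abs_lengthExpansion_le {σ b₁ b₂ b₃ z g ε d : ℝ} (hσ : 0 ≤ σ) (hε0 : 0 ≤ ε) (hε1 : ε ≤ 1)
    (hd1 : |d| ≤ 1) :
    |2 * z * ε * (σ + b₁ * d - b₂ * d ^ 2 + b₃ * d ^ 3) + ε ^ 2 + ε ^ 3 * g|
      ≤ 2 * |z| * (σ + |b₁| + |b₂| + |b₃|) + 1 + |g| := by
  have hd0 := abs_nonneg d
  have hd2 : |d| ^ 2 ≤ 1 := pow_le_one₀ hd0 hd1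
  have hd3 : |d| ^ 3 ≤ 1 := pow_le_one₀ hd0 hd1
  have hP : |σ + b₁ * d - b₂ * d ^ 2 + b₃ * d ^ 3| ≤ σ + |b₁| + |b₂| + |b₃| := by
    calc |σ + b₁ * d - b₂ * d ^ 2 + b₃ * d ^ 3|
        ≤ |σ + b₁ * d - b₂ * d ^ 2| + |b₃ * d ^ 3| := abs_add_le _ _
      _ ≤ |σ + b₁ * d| + |b₂ * d ^ 2| + |b₃ * d ^ 3| := by gcongr; exact abs_sub _ _
      _ ≤ |σ| + |b₁ * d| + |b₂ * d ^ 2| + |b₃ * d ^ 3| := by gcongr; exact abs_add_le _ _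
      _ = σ + |b₁| * |d| + |b₂| * |d| ^ 2 + |b₃| * |d| ^ 3 := by
          simp only [abs_mul, abs_pow, abs_of_nonneg hσ]
      _ ≤ σ + |b₁| * 1 + |b₂| * 1 + |b₃| * 1 := by gcongr
      _ = _ := by ring
  generalize σ + b₁ * d - b₂ * d ^ 2 + b₃ * d ^ 3 = P at *
  calc |2 * z * ε * P + ε ^ 2 + ε ^ 3 * g|
      ≤ |2 * z * ε * P| + |ε ^ 2| + |ε ^ 3 * g| := abs_add_three _ _ _
    _ = 2 * |z| * ε * |P| + ε ^ 2 + ε ^ 3 * |g| := by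
        simp only [abs_mul, abs_pow, abs_two, abs_of_nonneg hε0]
    _ ≤ 2 * |z| * 1 * (σ + |b₁| + |b₂| + |b₃|) + 1 + 1 * |g| := by
        gcongr
        · exact pow_le_one₀ hε0 hε1
        · exact pow_le_one₀ hε0 hε1
    _ = _ := by ring

/-! ### Expansion of the length and its mean -/

set_option maxHeartbeats 800000 in
/-- Expansion of the length of the interval, with an error that has a small mean. -/
theorem exists_abs_clopperPearsonLength_sub_le {α p : ℝ} (hα : α ∈ Set.Ioo (0 : ℝ) 1)
    (hp : p ∈ Set.Ioo (0 : ℝ) 1) {z : ℝ} (hz : z = stdNormalUpperQuantile (α / 2)) :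
    ∃ b₁ b₃ C : ℝ, 0 ≤ C ∧ ∀ᶠ n : ℕ in atTop, ∀ x : ℕ, x ≤ n →
      |clopperPearsonLength n α x - (2 * z * (√n)⁻¹ * (bsd p + b₁ * (x / n - p)
          - 1 / (8 * bsd p ^ 3) * (x / n - p) ^ 2 + b₃ * (x / n - p) ^ 3) + (√n)⁻¹ ^ 2
          + (√n)⁻¹ ^ 3 * lengthCoeff z p)|
        ≤ C * ((x / n - p) ^ 4 + (√n)⁻¹ ^ 2 * (x / n - p) ^ 2 + (√n)⁻¹ ^ 4) := by
  -- The factor 2 leaves room: |d| ≤ a keeps both r and 1 - r in [a, 1 - a].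
  obtain ⟨a, ha, ha', hap, hap'⟩ : ∃ a, 0 < a ∧ a ≤ 1 / 2 ∧ 2 * a ≤ p ∧ 2 * a ≤ 1 - p := by
    refine ⟨min p (1 - p) / 2, ?_, ?_, ?_, ?_⟩
    · have := lt_min hp.1 (sub_pos.2 hp.2); linarith
    · linarith [min_le_left p (1 - p), hp.2]
    · linarith [min_le_left p (1 - p)]
    · linarith [min_le_right p (1 - p)]
  obtain ⟨b₁, b₃, C₁, δ, hC₁, hδ, hδa, hT⟩ := exists_abs_bsd_add_sub_le hp.1 hp.2 ha
  obtain ⟨C₂, hC₂, hG⟩ := exists_abs_lengthCoeff_sub_le z ha ha'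
  obtain ⟨H, hH, hev⟩ := exists_abs_clopperPearsonLower_sub_le ha ha' hα
  rw [← hz] at hev
  set b₂ := 1 / (8 * bsd p ^ 3) with hb₂
  set B := 2 * |z| * (bsd p + |b₁| + |b₂| + |b₃|) + 1 + |lengthCoeff z p| with hB
  have hσ := bsd_nonneg p
  have hB0 : 0 ≤ B := by positivity
  refine ⟨b₁, b₃, 2 * H + 2 * |z| * C₁ + C₂ + (1 + B) / δ ^ 4, by positivity, ?_⟩
  filter_upwards [hev, eventually_ge_atTop 1] with n hn hn1 x hx
  have hn1' : (1 : ℝ) ≤ n := by exact_mod_cast hn1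
  set ε := (√(n : ℝ))⁻¹ with hε
  have hε0 : 0 ≤ ε := by positivity
  have hε1 : ε ≤ 1 := inv_le_one_of_one_le₀ (Real.one_le_sqrt.2 hn1')
  set r : ℝ := (x : ℝ) / n with hr
  obtain ⟨d, hd⟩ : ∃ d, d = r - p := ⟨_, rfl⟩
  have hrd : r = p + d := by linarith
  rw [← hd]
  have hr0 : 0 ≤ r := by positivity
  have hr1 : r ≤ 1 := div_le_one_of_le₀ (by exact_mod_cast hx) (by positivity)
  have hd1 : |d| ≤ 1 := by
    rw [abs_le]; constructor <;> linarith [hp.1, hp.2]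
  have q1 : 0 ≤ d ^ 4 := by positivity
  have q2 : 0 ≤ ε ^ 2 * d ^ 2 := by positivity
  have q3 : 0 ≤ ε ^ 4 := by positivity
  set R := d ^ 4 + ε ^ 2 * d ^ 2 + ε ^ 4 with hR
  have hR0 : 0 ≤ R := by positivity
  -- Near p the uniform expansions apply. Far from p both length and expansion are bounded, and 1 ≤
  -- d⁴/δ⁴ as in Markov's inequality.
  rcases le_or_gt |d| δ with hdδ | hdδ
  · have hda := abs_le.1 (hdδ.trans hδa)
    have hrm : r ∈ Set.Icc a (1 - a) := ⟨by linarith, by linarith⟩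
    have hrm' : 1 - r ∈ Set.Icc a (1 - a) := ⟨by linarith [hrm.2], by linarith [hrm.1]⟩
    have hpm : p ∈ Set.Icc a (1 - a) := ⟨by linarith, by linarith⟩
    have hnx : ((n - x : ℕ) : ℝ) / n = 1 - r := by
      rw [Nat.cast_sub hx, hr]; field_simp
    have l1 := hn x hx hrm
    have l2 := hn (n - x) (Nat.sub_le n x) (by rw [hnx]; exact hrm')
    rw [hnx] at l2
    have hsum := one_sub_cfT_sub_cfT (by linarith [hrm.1] : 0 < r) (by linarith [hrm.2]) ε z
    have t1 := hT d hdδ (by linarith) (by linarith)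
    have t2 := hG p hpm r hrm
    rw [← hd] at t2
    rw [← hrd] at t1
    rw [clopperPearsonLength, clopperPearsonUpper_eq_one_sub hx hα]
    set P := bsd p + b₁ * d - b₂ * d ^ 2 + b₃ * d ^ 3
    have split : 1 - clopperPearsonLower n α (n - x) - clopperPearsonLower n α x
        - (2 * z * ε * P + ε ^ 2 + ε ^ 3 * lengthCoeff z p)
        = -(clopperPearsonLower n α (n - x) - cfT (1 - r) ε (-z))
          - (clopperPearsonLower n α x - cfT r ε (-z))
          + 2 * z * ε * (bsd r - P) + ε ^ 3 * (lengthCoeff z r - lengthCoeff z p) := by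
      linear_combination hsum
    rw [split]
    have s1 : |2 * z * ε * (bsd r - P)| ≤ 2 * |z| * C₁ * d ^ 4 := by
      rw [abs_mul, abs_mul, abs_mul, abs_two, abs_of_nonneg hε0]
      calc 2 * |z| * ε * |bsd r - P| ≤ 2 * |z| * 1 * (C₁ * d ^ 4) := by gcongr
        _ = _ := by ring
    have s2 : |ε ^ 3 * (lengthCoeff z r - lengthCoeff z p)| ≤ C₂ * R := by
      rw [abs_mul, abs_of_nonneg (by positivity : 0 ≤ ε ^ 3)]
      have hy : ε ^ 3 * |d| ≤ R := by
        have h1 : ε ^ 3 * |d| ≤ (ε ^ 4 + ε ^ 2 * d ^ 2) / 2 := by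
          have := mul_nonneg (sq_nonneg ε) (sq_nonneg (ε - |d|))
          nlinarith [sq_abs d]
        linarith
      calc ε ^ 3 * |lengthCoeff z r - lengthCoeff z p| ≤ ε ^ 3 * (C₂ * |d|) := by gcongr
        _ = C₂ * (ε ^ 3 * |d|) := by ring
        _ ≤ C₂ * R := by gcongr
    have hz1 : 2 * |z| * C₁ * d ^ 4 ≤ 2 * |z| * C₁ * R := by gcongr; linarith
    have hH1 : H * ε ^ 4 ≤ H * R := by gcongr; linarith
    have hBR : 0 ≤ (1 + B) / δ ^ 4 * R := by positivity
    rw [abs_le] at l1 l2 s1 s2 ⊢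
    constructor <;> linarith [l1.1, l1.2, l2.1, l2.2, s1.1, s1.2, s2.1, s2.2]
  · have hL := abs_clopperPearsonLength_le hx hα
    have hA := abs_lengthExpansion_le (b₁ := b₁) (b₂ := b₂) (b₃ := b₃) (z := z)
      (g := lengthCoeff z p) hσ hε0 hε1 hd1
    rw [← hB] at hA
    set P := bsd p + b₁ * d - b₂ * d ^ 2 + b₃ * d ^ 3
    have hδd : 1 ≤ d ^ 4 / δ ^ 4 := by
      rw [one_le_div (by positivity), ← (by decide : Even 4).pow_abs d]
      gcongr
    calc |clopperPearsonLength n α x - (2 * z * ε * P + ε ^ 2 + ε ^ 3 * lengthCoeff z p)|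
        ≤ |clopperPearsonLength n α x| + |2 * z * ε * P + ε ^ 2 + ε ^ 3 * lengthCoeff z p| :=
          abs_sub _ _
      _ ≤ 1 + B := add_le_add hL hA
      _ ≤ (1 + B) * (d ^ 4 / δ ^ 4) := le_mul_of_one_le_right (by positivity) hδd
      _ = (1 + B) / δ ^ 4 * d ^ 4 := by ring
      _ ≤ (1 + B) / δ ^ 4 * R := by gcongr; linarith
      _ ≤ _ := by
        gcongr
        have : 0 ≤ 2 * H + 2 * |z| * C₁ + C₂ := by positivity
        linarith

lemma binomialMean_error_le {n : ℕ} (hn : n ≠ 0) {p C ε : ℝ} (hp0 : 0 ≤ p) (hp1 : p ≤ 1)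
    (hC : 0 ≤ C) (hε0 : 0 ≤ ε) (hε1 : ε ≤ 1) (hε : (n : ℝ)⁻¹ = ε ^ 2) :
    binomialMean n p (fun k => C * (((k : ℝ) / n - p) ^ 4 + ε ^ 2 * ((k : ℝ) / n - p) ^ 2 + ε ^ 4))
      ≤ 5 * C * ε ^ 4 := by
  have f : (fun k : ℕ => C * (((k : ℝ) / n - p) ^ 4 + ε ^ 2 * ((k : ℝ) / n - p) ^ 2 + ε ^ 4))
      = fun k : ℕ => C * ε ^ 4 + 0 * ((k : ℝ) / n - p) + C * ε ^ 2 * ((k : ℝ) / n - p) ^ 2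
        + 0 * ((k : ℝ) / n - p) ^ 3 + C * ((k : ℝ) / n - p) ^ 4 := by
    funext k; ring
  rw [f, binomialMean_poly_proportion hn, hε]
  have hv0 : 0 ≤ p * (1 - p) := mul_nonneg hp0 (by linarith)
  have hv1 : p * (1 - p) ≤ 1 / 4 := by nlinarith [sq_nonneg (p - 1 / 2)]
  generalize p * (1 - p) = v at *
  have hε6 : ε ^ 6 ≤ ε ^ 4 := pow_le_pow_of_le_one hε0 hε1 (by norm_num)
  have h4 : 0 ≤ ε ^ 4 := by positivity
  have h1 : v * (1 - 6 * v) * ε ^ 6 ≤ v * ε ^ 4 := by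
    calc v * (1 - 6 * v) * ε ^ 6 ≤ v * 1 * ε ^ 6 := by gcongr; linarith
      _ ≤ v * ε ^ 4 := by rw [mul_one]; gcongr
  have h2 : 3 * v ^ 2 ≤ 1 := by nlinarith
  calc _ = C * (ε ^ 4 + v * ε ^ 4 + 3 * v ^ 2 * ε ^ 4 + v * (1 - 6 * v) * ε ^ 6) := by ring
    _ ≤ C * (ε ^ 4 + 1 * ε ^ 4 + 1 * ε ^ 4 + v * ε ^ 4) := by gcongr; linarith
    _ ≤ C * (ε ^ 4 + 1 * ε ^ 4 + 1 * ε ^ 4 + 1 * ε ^ 4) := by gcongr; linarith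
    _ ≤ 5 * C * ε ^ 4 := by nlinarith [mul_nonneg hC h4]

theorem theorem2 (α p : ℝ) (hα : α ∈ Set.Ioo (0 : ℝ) 1) (hp : p ∈ Set.Ioo (0 : ℝ) 1)
    (q z : ℝ) (hq : q = 1 - p) (hz : z = stdNormalUpperQuantile (α / 2)) :
    (fun n : ℕ =>
      expectedClopperPearsonLength n α ⟨p, Set.Ioo_subset_Icc_self hp⟩
        - (2 * z * (n : ℝ) ^ (-(1 / 2) : ℝ) * (p * q) ^ (1 / 2 : ℝ)
            + (n : ℝ) ^ (-1 : ℝ)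
            + (n : ℝ) ^ (-(3 / 2) : ℝ) * (p * q) ^ (-(1 / 2) : ℝ) * (z / 18)
                * (z ^ 2 - 5 / 2 - 17 * (p * q) - 13 * (p * q) * z ^ 2)))
      =O[Filter.atTop] (fun n : ℕ => (n : ℝ) ^ (-2 : ℝ)) := by
  subst hq
  obtain ⟨b₁, b₃, C, hC, hev⟩ := exists_abs_clopperPearsonLength_sub_le hα hp hz
  have hv : 0 < p * (1 - p) := mul_pos hp.1 (by linarith [hp.2])
  have hσ : 0 < bsd p := Real.sqrt_pos.2 hv
  have hsq := bsd_sq hp.1 hp.2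
  set c₃ := 2 * z * b₃ * (p * (1 - p) * (1 - 2 * p)) with hc₃
  refine Asymptotics.IsBigO.of_bound (5 * C + |c₃|) ?_
  filter_upwards [hev, eventually_ge_atTop 1] with n hn hn1
  have hn1' : (1 : ℝ) ≤ n := by exact_mod_cast hn1
  have hn0 : (0 : ℝ) < n := by linarith
  set ε := (√(n : ℝ))⁻¹ with hε
  have hε0 : 0 < ε := by positivity
  have hε1 : ε ≤ 1 := inv_le_one_of_one_le₀ (Real.one_le_sqrt.2 hn1')
  have hninv : (n : ℝ)⁻¹ = ε ^ 2 := by rw [hε, inv_pow, Real.sq_sqrt hn0.le]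
  have r1 : (n : ℝ) ^ (-(1 / 2) : ℝ) = ε := by
    rw [Real.rpow_neg hn0.le, ← Real.sqrt_eq_rpow]
  have r2 : (n : ℝ) ^ (-1 : ℝ) = ε ^ 2 := by rw [Real.rpow_neg_one, hninv]
  have r3 : (n : ℝ) ^ (-(3 / 2) : ℝ) = ε ^ 3 := by
    rw [show (-(3 / 2) : ℝ) = -(1 / 2) + -1 by norm_num, Real.rpow_add hn0, r1, r2]; ring
  have r4 : (n : ℝ) ^ (-2 : ℝ) = ε ^ 4 := by
    rw [show (-2 : ℝ) = -1 + -1 by norm_num, Real.rpow_add hn0, r2]; ring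
  have r5 : (p * (1 - p)) ^ (1 / 2 : ℝ) = bsd p := by rw [← Real.sqrt_eq_rpow, bsd]
  have r6 : (p * (1 - p)) ^ (-(1 / 2) : ℝ) = (bsd p)⁻¹ := by rw [Real.rpow_neg hv.le, r5]
  rw [r1, r2, r3, r4, r5, r6, expectedClopperPearsonLength_eq, Real.norm_eq_abs, Real.norm_eq_abs,
    abs_of_pos (by positivity : 0 < ε ^ 4)]
  change |binomialMean n p (clopperPearsonLength n α) - _| ≤ _
  have hmean := abs_binomialMean_le hp.1.le hp.2.le hn
  rw [binomialMean_sub] at hmean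
  have m1 := binomialMean_poly_proportion (by omega : n ≠ 0) p
    (2 * z * ε * bsd p + ε ^ 2 + ε ^ 3 * lengthCoeff z p) (2 * z * ε * b₁)
    (-(2 * z * ε * (1 / (8 * bsd p ^ 3)))) (2 * z * ε * b₃) 0
  have f1 : (fun k : ℕ => 2 * z * ε * (bsd p + b₁ * ((k : ℝ) / n - p)
          - 1 / (8 * bsd p ^ 3) * ((k : ℝ) / n - p) ^ 2 + b₃ * ((k : ℝ) / n - p) ^ 3) + ε ^ 2
          + ε ^ 3 * lengthCoeff z p)
      = fun k : ℕ => (2 * z * ε * bsd p + ε ^ 2 + ε ^ 3 * lengthCoeff z p)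
        + 2 * z * ε * b₁ * ((k : ℝ) / n - p)
        + -(2 * z * ε * (1 / (8 * bsd p ^ 3))) * ((k : ℝ) / n - p) ^ 2
        + 2 * z * ε * b₃ * ((k : ℝ) / n - p) ^ 3 + 0 * ((k : ℝ) / n - p) ^ 4 := by
    funext k; ring
  rw [f1, m1, hninv] at hmean
  -- The variance term equals -zε³/(4σ) = (z/18)(-9/2)ε³/σ, and 2 - 9/2 = -5/2.
  have hmain : 2 * z * ε * bsd p + ε ^ 2 + ε ^ 3 * lengthCoeff z p
        + -(2 * z * ε * (1 / (8 * bsd p ^ 3))) * (p * (1 - p)) * ε ^ 2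
      = 2 * z * ε * bsd p + ε ^ 2 + ε ^ 3 * (bsd p)⁻¹ * (z / 18)
          * (z ^ 2 - 5 / 2 - 17 * (p * (1 - p)) - 13 * (p * (1 - p)) * z ^ 2) := by
    rw [lengthCoeff, ← hsq]
    field_simp
    ring
  have hε5 : ε ^ 5 ≤ ε ^ 4 := pow_le_pow_of_le_one hε0.le hε1 (by norm_num)
  have hbound := binomialMean_error_le (by omega : n ≠ 0) hp.1.le hp.2.le hC hε0.le hε1 hninv
  -- The third moment of d is of order ε⁴, and the prefactor supplies one more ε.
  have hc : |2 * z * ε * b₃ * (p * (1 - p) * (1 - 2 * p)) * (ε ^ 2) ^ 2| ≤ |c₃| * ε ^ 4 := by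
    rw [show 2 * z * ε * b₃ * (p * (1 - p) * (1 - 2 * p)) * (ε ^ 2) ^ 2 = c₃ * ε ^ 5 by
      rw [hc₃]; ring, abs_mul, abs_of_pos (pow_pos hε0 5)]
    gcongr
  have hmean' := abs_le.1 (hmean.trans hbound)
  have hc' := abs_le.1 hc
  rw [← hmain, abs_le]
  constructor <;> linarith [hmean'.1, hmean'.2, hc'.1, hc'.2]
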